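/- \textbf{Notation.} An index is a tuple $\boldsymbol{k}=(k_1,\dots,k_r)$ of positive integers; $I_{k,r}$ is the set of indices with $k_1+\cdots+k_r=k$ and depth $r$. An index is admissible if it is empty or $k_r\ge 2$; for admissible $\boldsymbol k$ put $\zeta(\boldsymbol{k})=\sum_{0<n_1<\cdots<n_r}n_1^{-k_1}\cdots n_r^{-k_r}$. Let $n$ be a positive integer. \emph{Case $\mathcal F=\mathcal A$.} Let $\mathcal A_n=\prod_p(\mathbb Z/p^n\mathbb Z)\big/\bigoplus_p(\mathbb Z/p^n\mathbb Z)$, with $p$ running over the primes (a $\mathbb Q$-algebra), and $$\zeta_{\mathcal A_n}(\boldsymbol k)=\Bigl(\sum_{0<n_1<\cdots<n_r<p}\frac1{n_1^{k_1}\cdots n_r^{k_r}}\bmod p^n\Bigr)_p,\qquad \zeta^\star_{\mathcal A_n}(\boldsymbol k)=\Bigl(\sum_{1\le n_1\le\cdots\le n_r\le p-1}\frac1{n_1^{k_1}\cdots n_r^{k_r}}\bmod p^n\Bigr)_p,$$ $$x_{\mathcal A_n}=(p\bmod p^n)_p,\qquad \mathfrak Z_{\mathcal A_n}(m)=\Bigl(\frac{B_{p^{n-1}(p-1)-m+1}}{m-1+p^{n-1}}\bmod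 p^n\Bigr)_p\quad(m\ge2),$$ where $B_j$ are the Bernoulli numbers (elements of $\mathcal A_n$ are determined by their components at all sufficiently large $p$). \emph{Case $\mathcal F=\mathcal S$.} Let $\mathcal Z\subset\mathbb R$ be the $\mathbb Q$-subalgebra generated by all $\zeta(\boldsymbol k)$ with $\boldsymbol k$ admissible, and $\overline{\mathcal Z}=\mathcal Z/\zeta(2)\mathcal Z$. Let $\mathfrak H^1$ be the $\mathbb Q$-vector space with basis the words $e_{\boldsymbol k}=e_{k_1}\cdots e_{k_r}$ ($\boldsymbol k$ an index), with the harmonic product defined bilinearly by $1*w=w*1=w$ and $e_au*e_bv=e_a(u*e_bv)+e_b(e_au*v)+e_{a+b}(u*v)$, and let $\mathfrak H^0$ be the span of the admissible words. Every $a\in\mathfrak H^1$ has a unique expression $a=\sum_ia_i*e_1^{*i}$ with $a_i\in\mathfrak H^0$; put $\mathrm{reg}_*(a)=a_0$, and let $\zeta^*(\boldsymbol k)$ be the image of $\mathrm{reg}_*(e_{\boldsymbol k})$ under the linear map $\mathfrak H^0\to\mathcal Z$, $e_{\boldsymbol l}\mapsto\zeta(\boldsymbol l)$. Let $\zeta_{\widehat{\mathcal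 S}}(\boldsymbol k)\in\overline{\mathcal Z}[[t]]$ be the reduction modulo $\zeta(2)$ of $$\sum_{i=0}^r(-1)^{k_{i+1}+\cdots+k_r}\zeta^*(k_1,\dots,k_i)\sum_{l_{i+1},\dots,l_r\ge0}\Bigl[\prod_{j=i+1}^r\binom{k_j+l_j-1}{l_j}\Bigr]\zeta^*(k_r+l_r,\dots,k_{i+1}+l_{i+1})\,t^{l_{i+1}+\cdots+l_r},$$ let $\zeta^\star_{\widehat{\mathcal S}}(\boldsymbol k)=\sum\zeta_{\widehat{\mathcal S}}(k_1\square\cdots\square k_r)$, the sum over all ways of replacing each $\square$ by a comma or a plus, and let $\zeta_{\mathcal S_n}(\boldsymbol k)$, $\zeta^\star_{\mathcal S_n}(\boldsymbol k)$ be their images in $\overline{\mathcal Z}[[t]]/(t^n)$. Put $x_{\mathcal S_n}=t\bmod t^n$ and $\mathfrak Z_{\mathcal S_n}(m)=\zeta(m)\bmod\zeta(2)$ $(m\ge 2)$ in $\overline{\mathcal Z}[[t]]/(t^n)$. \textbf{Theorem.} Let $r,k$ be positive integers with $r\le k$, let $\mathcal F\in\{\mathcal A,\mathcal S\}$, and put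 $S_{\mathcal F_n;k,r}=\sum_{\boldsymbol k\in I_{k,r}}\zeta_{\mathcal F_n}(\boldsymbol k)$ and $S^\star_{\mathcal F_n;k,r}=\sum_{\boldsymbol k\in I_{k,r}}\zeta^\star_{\mathcal F_n}(\boldsymbol k)$. Then $$S_{\mathcal F_2;k,r}=(-1)^{r-1}\binom kr\mathfrak Z_{\mathcal F_2}(k+1)x_{\mathcal F_2},\qquad S^\star_{\mathcal F_2;k,r}=\binom kr\mathfrak Z_{\mathcal F_2}(k+1)x_{\mathcal F_2},$$ and $$S_{\mathcal F_3;k,r}=(-1)^{k+r-1}\Bigl[\binom kr\mathfrak Z_{\mathcal F_3}(k+1)x_{\mathcal F_3}+\Bigl\{\frac{k+1}2\binom kr\mathfrak Z_{\mathcal F_3}(k+2)-\frac1{r!}T_{k,r}\Bigr\}x_{\mathcal F_3}^2\Bigr],$$ $$S^\star_{\mathcal F_3;k,r}=(-1)^{k}\Bigl[\binom kr\mathfrak Z_{\mathcal F_3}(k+1)x_{\mathcal F_3}+\Bigl\{\frac{k+1}2\binom kr\mathfrak Z_{\mathcal F_3}(k+2)+\frac1{r!}T_{k,r}\Bigr\}x_{\mathcal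 F_3}^2\Bigr],$$ where $$T_{k,r}=\sum_{\{B_1,B_2\}}\ \sum_{\substack{b_1+b_2=k\\ b_1\ge\#B_1,\ b_2\ge\#B_2}}(b_1)_{\#B_1}(b_2)_{\#B_2}\,\mathfrak Z_{\mathcal F_3}(b_1+1)\mathfrak Z_{\mathcal F_3}(b_2+1).$$ Here $\{B_1,B_2\}$ runs over the (unordered) partitions of $\{1,\dots,r\}$ into two non-empty blocks, the inner sum is over pairs of integers $(b_1,b_2)$, with $b_i$ attached to the block $B_i$, and $(a)_m=a(a-1)\cdots(a-m+1)$. -/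

import Mathlib

/-!
Finite multiple zeta values `ζ_{A_n}`, `ζ_{S_n}` and the sums entering the sum formulas.
An index `(k_1, …, k_r)` is a list of positive integers; it also stands for the word
`e_{k_1} ⋯ e_{k_r}`.
-/

namespace FMZV

/-- An index: a finite tuple of positive integers. -/
abbrev Index : Type := List ℕ+

/-- The weight `k_1 + ⋯ + k_r`. -/
def wt (k : Index) : ℕ := (k.map (fun a : ℕ+ => (a : ℕ))).sum

/-- The set `I_{k,r}` of indices of weight `k` and depth `r`. -/
def indexSet (k r : ℕ) : Set Index := {l | wt l = k ∧ l.length = r}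

theorem indexSet_finite (k r : ℕ) : (indexSet k r).Finite := by
  induction r generalizing k with
  | zero =>
    refine (Set.finite_singleton ([] : Index)).subset ?_
    rintro l ⟨_, hl⟩
    simpa using hl
  | succ r ih =>
    have h : (⋃ a ∈ Set.Iic (k.succPNat), ⋃ m ∈ Set.Iic k,
        (fun l : Index => a :: l) '' indexSet m r).Finite :=
      Set.Finite.biUnion (Set.finite_Iic _) fun a _ =>
        Set.Finite.biUnion (Set.finite_Iic _) fun m _ => (ih m).image _
    refine h.subset ?_
    rintro l ⟨hw, hl⟩
    match l, hl with
    | a :: l, hl =>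
      have hw' : (a : ℕ) + wt l = k := by simpa [wt] using hw
      simp only [Set.mem_iUnion, Set.mem_image]
      refine ⟨a, ?_, wt l, ?_, l, ⟨rfl, by simpa using hl⟩, rfl⟩
      · change (a : ℕ) ≤ k + 1
        omega
      · change wt l ≤ k
        omega

/-- `I_{k,r}` as a finite set. -/
noncomputable def I (k r : ℕ) : Finset Index := (indexSet_finite k r).toFinset

/-! ### The ring `A_n` and its multiple zeta values -/

/-- The ideal `⨁_p ℤ/p^n` of `∏_p ℤ/p^n`: families with finite support. -/
def finSuppIdeal (n : ℕ) : Ideal (∀ p : Nat.Primes, ZMod ((p : ℕ) ^ n)) where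
  carrier := {f | {p | f p ≠ 0}.Finite}
  zero_mem' := by simp
  add_mem' := by
    intro f g hf hg
    refine (Set.Finite.union hf hg).subset ?_
    intro p hp
    by_contra h
    simp only [Set.mem_union, Set.mem_ofPred_eq, not_or, not_not] at h
    exact hp (by simp [h.1, h.2])
  smul_mem' := by
    intro c f hf
    refine Set.Finite.subset hf ?_
    intro p hp h
    exact hp (by simp [h])

/-- `A_n = ∏_p ℤ/p^n / ⨁_p ℤ/p^n`. -/
abbrev ARing (n : ℕ) : Type := (∀ p : Nat.Primes, ZMod ((p : ℕ) ^ n)) ⧸ finSuppIdeal n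

/-- The class in `A_n` of a family `(a_p)_p`. -/
def ARing.mk (n : ℕ) (a : ∀ p : Nat.Primes, ZMod ((p : ℕ) ^ n)) : ARing n :=
  Ideal.Quotient.mk (finSuppIdeal n) a

/-- Nonzero integers are invertible in `A_n`. -/
theorem ARing.isUnit_natCast (n m : ℕ) (hm : m ≠ 0) : IsUnit (m : ARing n) := by
  refine IsUnit.of_mul_eq_one (ARing.mk n fun p => ((m : ZMod ((p : ℕ) ^ n)))⁻¹) ?_
  have h : (m : ARing n) = ARing.mk n (fun p => (m : ZMod ((p : ℕ) ^ n))) := rfl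
  rw [h]
  change Ideal.Quotient.mk (finSuppIdeal n) _ * Ideal.Quotient.mk (finSuppIdeal n) _ = 1
  rw [← map_mul, ← map_one (Ideal.Quotient.mk (finSuppIdeal n)), Ideal.Quotient.eq]
  have hfin : ((fun p : Nat.Primes => (p : ℕ)) ⁻¹' Set.Iic m).Finite :=
    (Set.finite_Iic m).preimage (fun a _ b _ hab => Subtype.ext hab)
  refine hfin.subset ?_
  intro p hp
  by_contra hlt
  have hlt' : m < (p : ℕ) := not_le.mp hlt
  refine hp ?_
  have hc : Nat.Coprime m ((p : ℕ) ^ n) := by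
    refine Nat.Coprime.pow_right n (Nat.Coprime.symm ?_)
    exact (Nat.Prime.coprime_iff_not_dvd p.2).2
      (fun hd => absurd (Nat.le_of_dvd (Nat.pos_of_ne_zero hm) hd) (by omega))
  simp [ZMod.coe_mul_inv_eq_one m hc]

/-- `A_n` is a `ℚ`-algebra. -/
noncomputable instance ARing.algebraRat (n : ℕ) : Algebra ℚ (ARing n) :=
  (IsLocalization.lift (M := nonZeroDivisors ℤ) (S := ℚ) (g := Int.castRingHom (ARing n))
    (by
      rintro ⟨y, hy⟩
      have hy0 : y.natAbs ≠ 0 := by simpa using nonZeroDivisors.ne_zero hy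
      have hu := ARing.isUnit_natCast n _ hy0
      rcases Int.natAbs_eq y with h | h
      · rw [show (Int.castRingHom (ARing n)) y = ((y.natAbs : ℕ) : ARing n) by
          conv_lhs => rw [h]
          simp]
        exact hu
      · rw [show (Int.castRingHom (ARing n)) y = -((y.natAbs : ℕ) : ARing n) by
          conv_lhs => rw [h]
          simp]
        exact hu.neg)).toAlgebra

/-- The residue `q mod m` of a rational number whose denominator is prime to `m`. -/
def ratMod (m : ℕ) (q : ℚ) : ZMod m := (q.num : ZMod m) * (q.den : ZMod m)⁻¹

open Classical in
/-- `∑_{0 < n_1 < ⋯ < n_r < p} 1 / (n_1^{k_1} ⋯ n_r^{k_r})`. -/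
noncomputable def harmonicSum (p : ℕ) (k : Index) : ℚ :=
  ∑ m ∈ Fintype.piFinset (fun _ : Fin k.length => Finset.Ioo 0 p) with StrictMono m,
    ∏ i, 1 / (m i : ℚ) ^ (k.get i : ℕ)

open Classical in
/-- `∑_{1 ≤ n_1 ≤ ⋯ ≤ n_r ≤ p - 1} 1 / (n_1^{k_1} ⋯ n_r^{k_r})`. -/
noncomputable def harmonicStarSum (p : ℕ) (k : Index) : ℚ :=
  ∑ m ∈ Fintype.piFinset (fun _ : Fin k.length => Finset.Ioo 0 p) with Monotone m,
    ∏ i, 1 / (m i : ℚ) ^ (k.get i : ℕ)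

/-- The `A_n`-multiple zeta value. -/
noncomputable def zetaA (n : ℕ) (k : Index) : ARing n :=
  ARing.mk n fun p => ratMod ((p : ℕ) ^ n) (harmonicSum p k)

/-- The `A_n`-multiple zeta-star value. -/
noncomputable def zetaAStar (n : ℕ) (k : Index) : ARing n :=
  ARing.mk n fun p => ratMod ((p : ℕ) ^ n) (harmonicStarSum p k)

/-- `x_{A_n} = (p mod p^n)_p`. -/
def xA (n : ℕ) : ARing n := ARing.mk n fun p => ((p : ℕ) : ZMod ((p : ℕ) ^ n))

/-- `(B_{p^{n-1}(p-1)-k+1} / (k - 1 + p^{n-1}) mod p^n)_p`. The finitely many `p` for which the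
subtraction in the subscript is truncated do not matter in `A_n`. -/
noncomputable def frakZA (n k : ℕ) : ARing n :=
  ARing.mk n fun p => ratMod ((p : ℕ) ^ n)
    (bernoulli ((p : ℕ) ^ (n - 1) * ((p : ℕ) - 1) + 1 - k) /
      ((k : ℚ) - 1 + ((p : ℕ) : ℚ) ^ (n - 1)))

/-! ### Multiple zeta values and the harmonic regularization -/

/-- `k_r ≥ 2`; the empty index is allowed. -/
def Admissible (k : Index) : Prop := ∀ h : k ≠ [], 2 ≤ (k.getLast h : ℕ)

/-- `ζ(k) = ∑_{0 < n_1 < ⋯ < n_r} 1 / (n_1^{k_1} ⋯ n_r^{k_r})`, for admissible `k`. -/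
noncomputable def mzv (k : Index) : ℝ :=
  ∑' m : {m : Fin k.length → ℕ // StrictMono m ∧ ∀ i, 0 < m i},
    ∏ i, 1 / (m.1 i : ℝ) ^ (k.get i : ℕ)

/-- The `ℚ`-subalgebra of `ℝ` generated by all multiple zeta values. -/
noncomputable def MZVAlg : Subalgebra ℚ ℝ := Algebra.adjoin ℚ {x | ∃ k, Admissible k ∧ x = mzv k}

open Classical in
/-- `ζ(k)` as an element of the algebra of multiple zeta values (`0` if `k` is not admissible). -/
noncomputable def mzvIn (k : Index) : MZVAlg :=
  if h : Admissible k then ⟨mzv k, Algebra.subset_adjoin ⟨k, h, rfl⟩⟩ else 0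

/-- The space `𝔥¹` with basis the words `e_{k_1} ⋯ e_{k_r}`. -/
abbrev H1 : Type := Index →₀ ℚ

/-- The subspace `𝔥⁰` spanned by the admissible words. -/
noncomputable def H0 : Submodule ℚ H1 := Finsupp.supported ℚ ℚ {k | Admissible k}

/-- Left multiplication by the letter `e_a`. -/
noncomputable def consMap (a : ℕ+) : H1 →ₗ[ℚ] H1 := Finsupp.lmapDomain ℚ ℚ (List.cons a)

/-- The harmonic product of two words:
`e_a u * e_b v = e_a (u * e_b v) + e_b (e_a u * v) + e_{a+b} (u * v)`. -/
noncomputable def harmWord : Index → Index → H1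
  | [], v => Finsupp.single v 1
  | a :: u, [] => Finsupp.single (a :: u) 1
  | a :: u, b :: v =>
      consMap a (harmWord u (b :: v)) + consMap b (harmWord (a :: u) v)
        + consMap (a + b) (harmWord u v)
termination_by u v => u.length + v.length

/-- The harmonic product on `𝔥¹`, by bilinearity. -/
noncomputable def harm (f g : H1) : H1 :=
  f.sum fun u x => g.sum fun v y => (x * y) • harmWord u v

/-- The harmonic power `e_1 * ⋯ * e_1` (`i` factors). -/
noncomputable def e1Pow : ℕ → H1
  | 0 => Finsupp.single [] 1
  | i + 1 => harm (Finsupp.single [1] 1) (e1Pow i)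

/-- `a = ∑_i c_i * e_1^{* i}` with all `c_i` in `𝔥⁰`. -/
def IsExpansion (a : H1) (c : ℕ →₀ H1) : Prop :=
  (∀ i, c i ∈ H0) ∧ a = c.sum fun i ci => harm ci (e1Pow i)

open Classical in
/-- The harmonic regularization `reg_*`: the constant term `c_0` of the (unique) expansion
`a = ∑_i c_i * e_1^{* i}`. -/
noncomputable def reg (a : H1) : H1 :=
  if h : ∃ c, IsExpansion a c then h.choose 0 else 0

/-- The linear map `Z` on `𝔥⁰` sending `e_k` to `ζ(k)`. -/
noncomputable def Z (a : H1) : MZVAlg := a.sum fun k x => x • mzvIn k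

/-- The harmonic regularized multiple zeta value `ζ^*(k)`. -/
noncomputable def zetaReg (k : Index) : MZVAlg := Z (reg (Finsupp.single k 1))

/-! ### The ring and the multiple zeta values for `S_n` -/

/-- `(k_s + l_s, …, k_1 + l_1)` for `k = (k_1, …, k_s)`. -/
def shiftReverse (k : Index) (l : Fin k.length → ℕ) : Index :=
  (List.ofFn fun j => (⟨(k.get j : ℕ) + l j, Nat.add_pos_left (k.get j).pos _⟩ : ℕ+)).reverse

/-- The power series
`∑_i (-1)^{k_{i+1}+⋯+k_r} ζ^*(k_1,…,k_i) ∑_l ∏_j C(k_j+l_j-1, l_j) ζ^*(k_r+l_r,…,k_{i+1}+l_{i+1})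
t^{l_{i+1}+⋯+l_r}`, given by its coefficients. -/
noncomputable def zetaSHatReg (k : Index) : PowerSeries MZVAlg :=
  PowerSeries.mk fun m => ∑ i ∈ Finset.range (k.length + 1),
    (-1) ^ wt (k.drop i) * zetaReg (k.take i) *
      ∑ l ∈ Finset.piAntidiag (Finset.univ : Finset (Fin (k.drop i).length)) m,
        ((∏ j, ((((k.drop i).get j : ℕ) + l j - 1).choose (l j)) : ℕ) : MZVAlg) *
          zetaReg (shiftReverse (k.drop i) l)

/-- The algebra of multiple zeta values modulo the ideal generated by `ζ(2)`. -/
abbrev ZBar : Type := MZVAlg ⧸ Ideal.span {mzvIn [2]}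

/-- The `t`-adic symmetric multiple zeta value. -/
noncomputable def zetaSHat (k : Index) : PowerSeries ZBar :=
  PowerSeries.map (Ideal.Quotient.mk (Ideal.span {mzvIn [2]})) (zetaSHatReg k)

/-- All `a □ l_1 □ ⋯ □ l_s`, each box being a comma or a plus. -/
def mergesFrom (a : ℕ+) : Index → List Index
  | [] => [[a]]
  | b :: l => (mergesFrom b l).map (List.cons a) ++ mergesFrom (a + b) l

/-- All `k_1 □ ⋯ □ k_r`, each box being a comma or a plus (with repetitions). -/
def merges : Index → List Index
  | [] => [[]]
  | a :: l => mergesFrom a l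

/-- The `t`-adic symmetric multiple zeta-star value. -/
noncomputable def zetaSHatStar (k : Index) : PowerSeries ZBar := ((merges k).map zetaSHat).sum

/-- The target ring `ZBar[[t]] / (t^n)` of the `S_n`-multiple zeta values. -/
abbrev SRing (n : ℕ) : Type :=
  PowerSeries ZBar ⧸ Ideal.span {(PowerSeries.X : PowerSeries ZBar) ^ n}

/-- The natural projection `π_n`. -/
noncomputable def SRing.proj (n : ℕ) : PowerSeries ZBar →+* SRing n :=
  Ideal.Quotient.mk (Ideal.span {(PowerSeries.X : PowerSeries ZBar) ^ n})

/-- The `S_n`-multiple zeta value. -/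
noncomputable def zetaS (n : ℕ) (k : Index) : SRing n := SRing.proj n (zetaSHat k)

/-- The `S_n`-multiple zeta-star value. -/
noncomputable def zetaSStar (n : ℕ) (k : Index) : SRing n := SRing.proj n (zetaSHatStar k)

/-- `x_{S_n} = t mod t^n`. -/
noncomputable def xS (n : ℕ) : SRing n := SRing.proj n PowerSeries.X

/-- `ζ(k) mod ζ(2)`, for `k ≥ 2`. -/
noncomputable def frakZS (n k : ℕ) : SRing n :=
  SRing.proj n (PowerSeries.C (Ideal.Quotient.mk _ (mzvIn [k.toPNat'])))

/-! ### The sums in the sum formulas -/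

/-- `S_{k,r}`: the sum of the values `z(k)` over all indices in `I_{k,r}`. -/
noncomputable def S {R : Type*} [CommRing R] (z : Index → R) (k r : ℕ) : R := ∑ l ∈ I k r, z l

/-- `T_{k,r}`: the sum over all set partitions `{B_1, B_2}` of an `r`-element set into two
nonempty blocks, and over all ways of attaching to the blocks integers `b_1 ≥ #B_1`, `b_2 ≥ #B_2`
with `b_1 + b_2 = k`, of `(b_1)_{#B_1} (b_2)_{#B_2} 𝔷(b_1 + 1) 𝔷(b_2 + 1)`. -/
def T {R : Type*} [CommRing R] (𝔷 : ℕ → R) (k r : ℕ) : R :=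
  ∑ P : Finpartition (Finset.univ : Finset (Fin r)) with P.parts.card = 2,
    ∑ b ∈ Finset.piAntidiag P.parts k with ∀ B ∈ P.parts, B.card ≤ b B,
      ∏ B ∈ P.parts, (((b B).descFactorial B.card : ℕ) : R) * 𝔷 (b B + 1)

end FMZV

/-!
The sum of the words `e_k` over all indices of weight `k` and depth `r` is symmetric: as a
quasi-symmetric function it is a coefficient of the elementary symmetric function of the power
series `x z / (1 - x z)`. It is therefore a polynomial in the words of depth one, and Newton's
identity (`IsStuffle.newton`) computes it recursively. The only property of a family of values `z`
that this uses is the rule `z(a) z(w) = ∑ z(u)`, where `u` runs over the words obtained from `w` by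
inserting the letter `a` or by adding `a` to a letter; this is `IsStuffle`.

Both for `A_n` and for `S_n` the depth-one values are multiples of `x`, so modulo `x ^ 3` all triple
products of them vanish, and only the contributions of at most two blocks survive
(`IsStuffle.S_eq`). One block gives the terms with `𝔷(k + 1)` and `𝔷(k + 2)`, two blocks give
`T_{k,r}`. The star values, multiplied by `(-1) ^ depth`, satisfy the same product rule
(`IsStuffle.signed_starSum`), so that the star formulas follow from the same theorem.

It remains to establish the product rule and to compute the depth-one values.

* For `A_n` the rule holds for truncated harmonic sums (`isStuffle_harmonicFrom`). Euler's theorem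
  turns `∑ n ^ (-k)` into a power sum with positive exponent, and Faulhaber's formula with the
  von Staudt-Clausen theorem evaluates the latter modulo `p ^ 3` (`exists_sum_pow_eq`).
* For `S_n` the rule for the regularized values `ζ^*` follows from the one for convergent series by
  a small Weyl algebra: deleting a final letter `e_1` is a derivation `∂` of the harmonic product
  with kernel `𝔥⁰`, and `∂` and multiplication by `e_1` satisfy the canonical commutation relation.
  This gives existence and uniqueness of the expansion in powers of `e_1` (`exists_isExpansion`,
  `IsExpansion.unique`), and shows that the regularization is compatible with multiplication by a
  letter. The rule is preserved by reversal, by signs, by the shift `1 / n ↦ 1 / (n - t)` and by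
  convolution along deconcatenation, hence it holds for the `t`-adic symmetric values
  (`isStuffle_zetaSHat`). Even zeta values vanish modulo `ζ(2)` by Euler's formula, which leaves the
  stated depth-one values.
-/

namespace FMZV

open Finset.HasAntidiagonal (antidiagonal mem_antidiagonal)
open Filter Topology

/-! ### Stuffling a letter into a word -/

/-- The value on `e_a * e_w` (harmonic product of a letter and a word) of the linear functional with
value `z u` on the word `e_u`: the sum of `z` over all words obtained by inserting the letter `a`
into `w` or by adding `a` to a letter of `w`. -/
def stuffle {M : Type*} [AddCommMonoid M] (a : ℕ+) : Index → (Index → M) → M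
  | [], z => z [a]
  | b :: w, z => z (a :: b :: w) + z ((a + b) :: w) + stuffle a w (fun u => z (b :: u))

/-- `z` is multiplicative for the harmonic product of a letter and a word. -/
structure IsStuffle {R : Type*} [CommRing R] (z : Index → R) : Prop where
  nil : z [] = 1
  mul (a : ℕ+) (w : Index) : z [a] * z w = stuffle a w z

section AddCommMonoid

variable {M N : Type*} [AddCommMonoid M] [AddCommMonoid N]

theorem map_stuffle (f : M →+ N) (a : ℕ+) (w : Index) (z : Index → M) :
    f (stuffle a w z) = stuffle a w (fun u => f (z u)) := by
  induction w generalizing z with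
  | nil => rfl
  | cons b w ih => simp [stuffle, ih]

theorem stuffle_add (a : ℕ+) (w : Index) (y z : Index → M) :
    stuffle a w (fun u => y u + z u) = stuffle a w y + stuffle a w z := by
  induction w generalizing y z with
  | nil => rfl
  | cons b w ih =>
    simp only [stuffle, ih]
    abel

theorem stuffle_zero (a : ℕ+) (w : Index) : stuffle a w (fun _ => (0 : M)) = 0 := by
  induction w with
  | nil => rfl
  | cons b w ih => simp [stuffle, ih]

theorem stuffle_sum {ι : Type*} (s : Finset ι) (a : ℕ+) (w : Index) (z : ι → Index → M) :
    stuffle a w (fun u => ∑ i ∈ s, z i u) = ∑ i ∈ s, stuffle a w (z i) := by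
  classical
  induction s using Finset.induction_on with
  | empty => simp [stuffle_zero]
  | insert i s hi ih => simp [Finset.sum_insert hi, stuffle_add, ih]

theorem stuffle_smul {𝕜 : Type*} [Monoid 𝕜] [DistribMulAction 𝕜 M] (c : 𝕜) (a : ℕ+) (w : Index)
    (z : Index → M) : stuffle a w (fun u => c • z u) = c • stuffle a w z :=
  (map_stuffle (DistribSMul.toAddMonoidHom M c) a w z).symm

end AddCommMonoid

theorem stuffle_mul_left {R : Type*} [CommRing R] (c : R) (a : ℕ+) (w : Index) (z : Index → R) :
    stuffle a w (fun u => c * z u) = c * stuffle a w z :=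
  stuffle_smul c a w z

theorem IsStuffle.map {R R' : Type*} [CommRing R] [CommRing R'] {z : Index → R} (hz : IsStuffle z)
    (f : R →+* R') : IsStuffle (fun w => f (z w)) where
  nil := by simp [hz.nil]
  mul a w := by
    rw [← map_mul, hz.mul]
    exact map_stuffle f.toAddMonoidHom a w z

/-! ### Newton's identities for the sums over all indices -/

section Newton

variable {R : Type*} [CommRing R]

/-- `z` with a letter `j` prefixed; the value is `0` for `j = 0`, which is not a letter. -/
def prefixed (z : Index → R) : ℕ → Index → R
  | 0 => 0
  | j + 1 => fun u => z (j.succPNat :: u)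

/-- `stuffle` for a letter in `ℕ`; the value is `0` for `j = 0`, which is not a letter. -/
def stuffled (z : Index → R) : ℕ → Index → R
  | 0 => 0
  | j + 1 => fun u => stuffle j.succPNat u z

/-- The number of compositions of `j` into `i + 1` positive parts. -/
def numComp (i : ℕ) : ℕ → ℕ
  | 0 => 0
  | j + 1 => j.choose i

theorem mem_I {k r : ℕ} {l : Index} : l ∈ I k r ↔ wt l = k ∧ l.length = r := by
  simp [I, indexSet]

theorem S_zero (z : Index → R) (k : ℕ) : S z k 0 = if k = 0 then z [] else 0 := by
  have h : I k 0 = if k = 0 then {[]} else ∅ := by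
    ext l
    rw [mem_I]
    split_ifs with hk
    · constructor
      · rintro ⟨_, h⟩
        simpa using h
      · intro h
        simp only [Finset.mem_singleton] at h
        simp [h, wt, hk]
    · simp only [Finset.notMem_empty, iff_false, not_and]
      rintro h h'
      rw [List.length_eq_zero_iff] at h'
      subst h'
      exact hk (by simpa [wt] using h.symm)
  rw [S, h]
  split_ifs <;> simp

theorem S_succ (z : Index → R) (k s : ℕ) :
    S z k (s + 1) = ∑ x ∈ antidiagonal k, S (prefixed z x.1) x.2 s := by
  classical
  have h1 : ∀ x ∈ antidiagonal k, S (prefixed z x.1) x.2 s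
      = ∑ l ∈ I k (s + 1) with wt (l.take 1) = x.1, z l := by
    rintro ⟨j, m⟩ hx
    rw [mem_antidiagonal] at hx
    rw [S]
    cases j with
    | zero =>
      refine (Finset.sum_eq_zero fun _ _ => rfl).trans (Finset.sum_eq_zero ?_).symm
      intro l hl
      rw [Finset.mem_filter, mem_I] at hl
      match l, hl with
      | a :: l, hl => simp [wt] at hl
    | succ j =>
      refine Finset.sum_bij (fun l _ => j.succPNat :: l) ?_ ?_ ?_ ?_
      · intro l hl
        rw [mem_I] at hl
        rw [Finset.mem_filter, mem_I]
        have := hl.1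
        simp only [wt] at this
        simp only at hx
        simp [wt, this, hl.2, hx]
      · intro l _ l' _ h
        simpa using h
      · intro l hl
        rw [Finset.mem_filter, mem_I] at hl
        match l, hl with
        | a :: l, hl =>
          obtain ⟨⟨hw, hlen⟩, ha⟩ := hl
          simp only [wt, List.take_succ_cons, List.take_zero, List.map_cons, List.map_nil,
            List.sum_cons, List.sum_nil, add_zero] at ha
          simp only [wt, List.map_cons, List.sum_cons] at hw
          simp only at hx
          refine ⟨l, ?_, ?_⟩
          · rw [mem_I]
            refine ⟨?_, by simpa using hlen⟩
            simp only [wt]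
            omega
          · congr 1
            exact PNat.eq (by simpa using ha.symm)
      · intro l _
        rfl
  rw [Finset.sum_congr rfl h1, S]
  rw [← Finset.sum_fiberwise_of_maps_to (s := I k (s + 1)) (t := Finset.range (k + 1))
    (g := fun l => wt (l.take 1))]
  · rw [Finset.Nat.sum_antidiagonal_eq_sum_range_succ_mk]
  · intro l hl
    rw [mem_I] at hl
    rw [Finset.mem_range]
    match l, hl with
    | [], hl => simp at hl
    | a :: l, hl =>
      have := hl.1
      simp only [wt, List.map_cons, List.sum_cons] at this
      simp only [wt, List.take_succ_cons, List.take_zero, List.map_cons, List.map_nil,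
        List.sum_cons, List.sum_nil, add_zero]
      omega

theorem S_add (y z : Index → R) (k s : ℕ) :
    S (fun u => y u + z u) k s = S y k s + S z k s := Finset.sum_add_distrib

theorem S_const_mul (c : R) (z : Index → R) (k s : ℕ) :
    S (fun u => c * z u) k s = c * S z k s := (Finset.mul_sum _ _ _).symm

theorem prefixed_stuffled (z : Index → R) (j m : ℕ) :
    prefixed (stuffled z j) m = fun u => prefixed (prefixed z j) m u
      + (if j = 0 ∨ m = 0 then 0 else prefixed z (j + m) u) + stuffled (prefixed z m) j u := by
  funext u
  cases m with
  | zero =>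
    cases j with
    | zero => simp [prefixed, stuffled]
    | succ j => exact (by simp [prefixed, stuffled]; exact (stuffle_zero _ _).symm)
  | succ m =>
    cases j with
    | zero => simp [prefixed, stuffled]
    | succ j =>
      have : j.succPNat + m.succPNat = (j + 1 + m).succPNat := PNat.eq (by simp; omega)
      simp [prefixed, stuffled, stuffle, this]

theorem sum_antidiagonal_numComp (i n : ℕ) :
    ∑ x ∈ antidiagonal n, (if x.1 = 0 ∨ x.2 = 0 then 0 else numComp i x.1)
      = numComp (i + 1) n := by
  cases n with
  | zero => simp [numComp]
  | succ n =>
    rw [Finset.Nat.sum_antidiagonal_eq_sum_range_succ_mk, Finset.sum_range_succ,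
      Finset.sum_range_succ']
    simp only [numComp, Nat.sub_self, or_true, if_true, add_zero, true_or]
    rw [Finset.sum_congr rfl (g := fun j => j.choose i)]
    · induction n with
      | zero => simp
      | succ n ih => rw [Finset.sum_range_succ, ih, Nat.choose_succ_succ, add_comm]
    · intro x hx
      rw [Finset.mem_range] at hx
      rw [if_neg (by omega)]

/-- The sum of `z` over all words of weight `k` with `s` letters, one of which is marked and counted
with the number of its compositions into `i + 1` parts. -/
noncomputable def markedSum (i : ℕ) : ℕ → (Index → R) → ℕ → R
  | 0, _, _ => 0
  | s + 1, z, k => ∑ x ∈ antidiagonal k, (numComp i x.1 : R) * S (prefixed z x.1) x.2 s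
      + ∑ x ∈ antidiagonal k, markedSum i s (prefixed z x.1) x.2

theorem markedSum_zero (s : ℕ) (z : Index → R) (k : ℕ) : markedSum 0 s z k = s * S z k s := by
  induction s generalizing z k with
  | zero => simp [markedSum]
  | succ s ih =>
    rw [markedSum, S_succ]
    simp only [ih, ← Finset.mul_sum]
    push_cast
    rw [add_comm, add_mul, one_mul]
    congr 1
    refine Finset.sum_congr rfl fun x _ => ?_
    rcases x with ⟨_ | j, m⟩
    · simp [numComp, prefixed, S]
    · simp [numComp]

/-- Stuffling a letter that carries `i + 1` compositions either inserts it as a new marked letter or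
merges it with a letter, which then carries `i + 2` compositions. -/
theorem sum_numComp_mul_S_stuffled (i s : ℕ) (z : Index → R) (k : ℕ) :
    ∑ x ∈ antidiagonal k, (numComp i x.1 : R) * S (stuffled z x.1) x.2 s
      = markedSum i (s + 1) z k + markedSum (i + 1) s z k := by
  induction s generalizing z k with
  | zero =>
    simp only [markedSum, S_zero, Finset.sum_const_zero, add_zero]
    refine Finset.sum_congr rfl fun x _ => ?_
    rcases x with ⟨_ | j, m⟩
    · simp [numComp]
    · simp [stuffled, stuffle, prefixed]
  | succ s ih =>
    have h3 : ∑ x ∈ antidiagonal k, ∑ y ∈ antidiagonal x.2,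
        (numComp i x.1 : R) * S (fun u => stuffled (prefixed z y.1) x.1 u) y.2 s
        = ∑ x ∈ antidiagonal k, (markedSum i (s + 1) (prefixed z x.1) x.2
          + markedSum (i + 1) s (prefixed z x.1) x.2) := by
      simp only [← ih]
      rw [Finset.sum_sigma', Finset.sum_sigma']
      refine Finset.sum_bij' (fun x _ => ⟨(x.2.1, x.1.1 + x.2.2), (x.1.1, x.2.2)⟩)
        (fun x _ => ⟨(x.2.1, x.1.1 + x.2.2), (x.1.1, x.2.2)⟩) ?_ ?_ ?_ ?_ ?_
      · rintro ⟨⟨a, b⟩, c, d⟩ h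
        simp only [Finset.mem_sigma, mem_antidiagonal] at h ⊢
        exact ⟨by omega, trivial⟩
      · rintro ⟨⟨a, b⟩, c, d⟩ h
        simp only [Finset.mem_sigma, mem_antidiagonal] at h ⊢
        exact ⟨by omega, trivial⟩
      · rintro ⟨⟨a, b⟩, c, d⟩ h
        simp only [Finset.mem_sigma, mem_antidiagonal] at h ⊢
        simp [h.2]
      · rintro ⟨⟨a, b⟩, c, d⟩ h
        simp only [Finset.mem_sigma, mem_antidiagonal] at h ⊢
        simp [h.2]
      · rintro ⟨⟨a, b⟩, c, d⟩ h
        rfl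
    have h2 : ∑ x ∈ antidiagonal k, ∑ y ∈ antidiagonal x.2, (numComp i x.1 : R)
          * S (fun u => if x.1 = 0 ∨ y.1 = 0 then 0 else prefixed z (x.1 + y.1) u) y.2 s
        = ∑ x ∈ antidiagonal k, (numComp (i + 1) x.1 : R) * S (prefixed z x.1) x.2 s := by
      simp only [← sum_antidiagonal_numComp, Nat.cast_sum, Finset.sum_mul]
      rw [Finset.sum_sigma', Finset.sum_sigma']
      refine Finset.sum_bij' (fun x _ => ⟨(x.1.1 + x.2.1, x.2.2), (x.1.1, x.2.1)⟩)
        (fun x _ => ⟨(x.2.1, x.2.2 + x.1.2), (x.2.2, x.1.2)⟩) ?_ ?_ ?_ ?_ ?_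
      · rintro ⟨⟨a, b⟩, c, d⟩ h
        simp only [Finset.mem_sigma, mem_antidiagonal] at h ⊢
        exact ⟨by omega, trivial⟩
      · rintro ⟨⟨a, b⟩, c, d⟩ h
        simp only [Finset.mem_sigma, mem_antidiagonal] at h ⊢
        exact ⟨by omega, trivial⟩
      · rintro ⟨⟨a, b⟩, c, d⟩ h
        simp only [Finset.mem_sigma, mem_antidiagonal] at h ⊢
        simp [h.2]
      · rintro ⟨⟨a, b⟩, c, d⟩ h
        simp only [Finset.mem_sigma, mem_antidiagonal] at h ⊢
        simp [h.2]
      · rintro ⟨⟨a, b⟩, c, d⟩ h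
        dsimp only
        split_ifs with hc
        · simp [S]
        · rfl
    simp only [S_succ, prefixed_stuffled, S_add, Finset.mul_sum, mul_add, Finset.sum_add_distrib]
      at h2 h3 ⊢
    rw [h2, h3]
    conv_rhs => rw [markedSum, markedSum]
    simp only [S_succ, Finset.mul_sum]
    ring

/-- **Newton's identity** for the sums over all indices. -/
theorem IsStuffle.newton {z : Index → R} (hz : IsStuffle z) (k r : ℕ) :
    r * S z k r = ∑ i ∈ Finset.range r, (-1) ^ i * ∑ x ∈ antidiagonal k,
      (numComp i x.1 : R) * (prefixed z x.1 [] * S z x.2 (r - 1 - i)) := by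
  have key : ∀ i s, ∑ x ∈ antidiagonal k,
      (numComp i x.1 : R) * (prefixed z x.1 [] * S z x.2 s)
        = markedSum i (s + 1) z k + markedSum (i + 1) s z k := by
    intro i s
    rw [← sum_numComp_mul_S_stuffled]
    refine Finset.sum_congr rfl fun x _ => ?_
    congr 1
    rw [← S_const_mul]
    congr 1
    funext u
    rcases x with ⟨_ | j, m⟩
    · simp [prefixed, stuffled]
    · exact hz.mul _ _
  have tel : ∀ n ≤ r, ∑ i ∈ Finset.range n, (-1 : R) ^ i
      * (markedSum i (r - i) z k + markedSum (i + 1) (r - (i + 1)) z k)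
      = markedSum 0 r z k - (-1) ^ n * markedSum n (r - n) z k := by
    intro n hn
    induction n with
    | zero => simp
    | succ n ih =>
      rw [Finset.sum_range_succ, ih (by omega), pow_succ]
      ring
  have h := tel r le_rfl
  rw [Nat.sub_self] at h
  simp only [markedSum, mul_zero, sub_zero, markedSum_zero] at h
  rw [← h]
  refine Finset.sum_congr rfl fun i hi => ?_
  rw [Finset.mem_range] at hi
  rw [key, show r - 1 - i + 1 = r - i by omega, show r - 1 - i = r - (i + 1) by omega]

end Newton

/-! ### Set partitions into two blocks -/

theorem sum_piAntidiag_pair {ι M : Type*} [DecidableEq ι] [AddCommMonoid M] {B C : ι} (h : B ≠ C)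
    (k : ℕ) (g : ℕ → ℕ → M) :
    ∑ b ∈ Finset.piAntidiag {B, C} k, g (b B) (b C) = ∑ x ∈ antidiagonal k, g x.1 x.2 := by
  refine Finset.sum_bij' (fun b _ => (b B, b C))
    (fun x _ i => if i = B then x.1 else if i = C then x.2 else 0) ?_ ?_ ?_ ?_ ?_
  · intro b hb
    rw [Finset.mem_piAntidiag, Finset.sum_pair h] at hb
    exact mem_antidiagonal.2 hb.1
  · intro x hx
    rw [mem_antidiagonal] at hx
    rw [Finset.mem_piAntidiag, Finset.sum_pair h]
    refine ⟨by simpa [h.symm] using hx, fun i hi => ?_⟩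
    by_contra hc
    simp only [Finset.mem_insert, Finset.mem_singleton, not_or] at hc
    simp [hc.1, hc.2] at hi
  · intro b hb
    rw [Finset.mem_piAntidiag] at hb
    funext i
    dsimp only
    split_ifs with h1 h2
    · rw [h1]
    · rw [h2]
    · by_contra hc
      have := hb.2 i (Ne.symm hc)
      simp [h1, h2] at this
  · intro x _
    simp [h.symm]
  · intro b _
    rfl

theorem parts_eq_pair {r : ℕ} (P : Finpartition (Finset.univ : Finset (Fin r)))
    (hP : P.parts.card = 2) {B : Finset (Fin r)} (hB : B ∈ P.parts) : P.parts = {B, Bᶜ} := by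
  obtain ⟨X, Y, hXY, h⟩ := Finset.card_eq_two.1 hP
  have hdis : Disjoint X Y := P.disjoint (by simp [h]) (by simp [h]) hXY
  have hsup : X ∪ Y = Finset.univ := by
    have := P.sup_parts
    rw [h] at this
    simpa using this
  have hc : IsCompl X Y := ⟨hdis, by rw [codisjoint_iff]; exact hsup⟩
  rw [h, Finset.mem_insert, Finset.mem_singleton] at hB
  rcases hB with rfl | rfl
  · rw [h, hc.compl_eq]
  · rw [h, hc.symm.compl_eq, Finset.pair_comm]

/-- The partition of `Fin r` into a proper nonempty subset and its complement. -/
def pairPartition {r : ℕ} (B : Finset (Fin r)) (h0 : B ≠ ∅) (h1 : B ≠ Finset.univ) :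
    Finpartition (Finset.univ : Finset (Fin r)) where
  parts := {B, Bᶜ}
  supIndep := by
    have hne : B ≠ Bᶜ := fun h => h0 (by
      have := disjoint_compl_right (a := B)
      rw [← h] at this
      exact disjoint_self.1 this)
    rw [Finset.supIndep_pair hne]
    exact disjoint_compl_right
  sup_parts := by simp
  bot_notMem := by
    simp only [Finset.bot_eq_empty, Finset.mem_insert, Finset.mem_singleton, not_or]
    exact ⟨h0.symm, fun h => h1 (by simpa using h.symm)⟩

section TwoBlocks

variable {R : Type*} [CommRing R]

/-- The contribution to `T_{k,r}` of one ordered pair of blocks of sizes `a` and `r - a`. -/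
def blockSum (𝔷 : ℕ → R) (k r a : ℕ) : R :=
  ∑ x ∈ antidiagonal k, ((x.1.descFactorial a : ℕ) : R) * 𝔷 (x.1 + 1)
    * (((x.2.descFactorial (r - a) : ℕ) : R) * 𝔷 (x.2 + 1))

/-- An unordered pair of blocks is counted twice when its blocks are put in order. -/
theorem two_mul_T (𝔷 : ℕ → R) (k r : ℕ) :
    2 * T 𝔷 k r = ∑ a ∈ Finset.range (r + 1),
      (r.choose a : R) * (if a = 0 ∨ a = r then 0 else blockSum 𝔷 k r a) := by
  have h1 : ∀ P : Finpartition (Finset.univ : Finset (Fin r)), P.parts.card = 2 →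
      ∀ B ∈ P.parts, (∑ b ∈ Finset.piAntidiag P.parts k with ∀ B ∈ P.parts, B.card ≤ b B,
        ∏ B ∈ P.parts, (((b B).descFactorial B.card : ℕ) : R) * 𝔷 (b B + 1))
        = blockSum 𝔷 k r B.card := by
    intro P hP B hB
    rw [Finset.sum_filter_of_ne]
    · have h := parts_eq_pair P hP hB
      have hne : B ≠ Bᶜ := by
        intro hc
        rw [h, ← hc] at hP
        simp at hP
      rw [h, blockSum, ← sum_piAntidiag_pair hne k (fun i j => ((i.descFactorial B.card : ℕ) : R)
        * 𝔷 (i + 1) * (((j.descFactorial (r - B.card) : ℕ) : R) * 𝔷 (j + 1)))]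
      refine Finset.sum_congr rfl fun b _ => ?_
      rw [Finset.prod_pair hne, Finset.card_compl, Fintype.card_fin]
    · intro b _ hb C hC
      by_contra hlt
      refine hb (Finset.prod_eq_zero hC ?_)
      rw [Nat.descFactorial_of_lt (not_le.1 hlt)]
      simp
  have h2 : 2 * T 𝔷 k r = ∑ P : Finpartition (Finset.univ : Finset (Fin r)) with P.parts.card = 2,
      ∑ B ∈ P.parts, blockSum 𝔷 k r B.card := by
    rw [T, Finset.mul_sum]
    refine Finset.sum_congr rfl fun P hP => ?_
    rw [Finset.mem_filter] at hP
    rw [Finset.sum_congr rfl (fun B hB => (h1 P hP.2 B hB).symm), Finset.sum_const, hP.2]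
    simp
  have h3 := Finset.sum_powerset_apply_card
    (fun a => if a = 0 ∨ a = r then (0 : R) else blockSum 𝔷 k r a)
    (x := (Finset.univ : Finset (Fin r)))
  simp only [Finset.card_univ, Fintype.card_fin, nsmul_eq_mul] at h3
  rw [h2, ← h3, Finset.sum_sigma']
  have h4 : ∀ B : Finset (Fin r), (B.card = 0 ∨ B.card = r) ↔ (B = ∅ ∨ B = Finset.univ) := by
    intro B
    rw [Finset.card_eq_zero, ← Finset.card_eq_iff_eq_univ, Fintype.card_fin]
  simp only [h4, Finset.powerset_univ]
  rw [← Finset.sum_filter_of_ne (p := fun B => ¬ (B = ∅ ∨ B = Finset.univ))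
    (fun B _ h hc => h (if_pos hc))]
  refine Finset.sum_bij (fun x _ => x.2) ?_ ?_ ?_ ?_
  · rintro ⟨P, B⟩ h
    rw [Finset.mem_sigma, Finset.mem_filter] at h
    obtain ⟨⟨-, hP⟩, hB⟩ := h
    rw [Finset.mem_filter]
    refine ⟨Finset.mem_univ _, ?_⟩
    have h := parts_eq_pair P hP hB
    rintro (rfl | rfl)
    · exact P.bot_notMem hB
    · refine P.bot_notMem ?_
      rw [h]
      simp
  · rintro ⟨P, B⟩ h ⟨P', B'⟩ h' hBB
    rw [Finset.mem_sigma, Finset.mem_filter] at h h'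
    dsimp only at hBB
    subst hBB
    have : P = P' := Finpartition.ext (by
      rw [parts_eq_pair P h.1.2 h.2, parts_eq_pair P' h'.1.2 h'.2])
    rw [this]
  · intro B hB
    rw [Finset.mem_filter, not_or] at hB
    refine ⟨⟨pairPartition B hB.2.1 hB.2.2, B⟩, ?_, rfl⟩
    rw [Finset.mem_sigma, Finset.mem_filter]
    refine ⟨⟨Finset.mem_univ _, ?_⟩, by simp [pairPartition]⟩
    refine Finset.card_pair fun h => hB.2.1 ?_
    have := disjoint_compl_right (a := B)
    rw [← h] at this
    exact disjoint_self.1 this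
  · rintro ⟨P, B⟩ h
    rw [Finset.mem_sigma, Finset.mem_filter] at h
    obtain ⟨⟨-, hP⟩, hB⟩ := h
    have h := parts_eq_pair P hP hB
    dsimp only at hB h ⊢
    rw [if_neg]
    rintro (rfl | rfl)
    · exact P.bot_notMem hB
    · refine P.bot_notMem ?_
      rw [h]
      simp

/-! ### Sums over all indices when triple products vanish -/

section SumFormula

variable {z : Index → R}

theorem IsStuffle.sum_numComp_S_zero (hz : IsStuffle z) (k i : ℕ) (f : ℕ → R) :
    ∑ x ∈ antidiagonal k, (numComp i x.1 : R) * (f x.1 * S z x.2 0) = numComp i k * f k := by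
  rw [Finset.sum_eq_single (k, 0)]
  · simp [S_zero, hz.nil]
  · rintro ⟨a, b⟩ h hne
    rw [mem_antidiagonal] at h
    have : b ≠ 0 := by
      rintro rfl
      exact hne (by simp_all)
    simp [S_zero, this]
  · intro h
    exact absurd (mem_antidiagonal.2 (add_zero k)) h

/-- The contribution of two blocks of sizes `a` and `b`, divided by `a! b!`. -/
def pairSum (w : ℕ → R) (k a b : ℕ) : R :=
  ∑ x ∈ antidiagonal k, (x.1.choose a : R) * (x.2.choose b : R) * (w x.1 * w x.2)

theorem pairSum_comm (w : ℕ → R) (k a b : ℕ) : pairSum w k a b = pairSum w k b a := by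
  rw [pairSum, ← Finset.Nat.sum_antidiagonal_swap, pairSum]
  refine Finset.sum_congr rfl fun x _ => ?_
  simp only [Prod.fst_swap, Prod.snd_swap]
  ring

theorem numComp_mul_cast (i j : ℕ) :
    (numComp i j : R) * (j : R) = ((i + 1 : ℕ) : R) * (j.choose (i + 1) : R) := by
  cases j with
  | zero => simp
  | succ j =>
    rw [numComp, ← Nat.cast_mul, ← Nat.cast_mul, mul_comm, Nat.add_one_mul_choose_eq, mul_comm]

theorem two_mul_T_eq_pairSum (w : ℕ → R) (k s : ℕ) :
    2 * T (fun m => w (m - 1)) k (s + 1)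
      = (s + 1).factorial * ∑ i ∈ Finset.range s, pairSum w k (i + 1) (s - i) := by
  rw [two_mul_T, Finset.sum_range_succ, Finset.sum_range_succ', Finset.mul_sum]
  simp only [true_or, or_true, if_true, mul_zero, add_zero]
  refine Finset.sum_congr rfl fun i hi => ?_
  rw [Finset.mem_range] at hi
  rw [if_neg (by omega), blockSum, pairSum, Finset.mul_sum, Finset.mul_sum]
  refine Finset.sum_congr rfl fun x _ => ?_
  rw [show s + 1 - (i + 1) = s - i by omega, Nat.add_sub_cancel, Nat.add_sub_cancel,
    Nat.descFactorial_eq_factorial_mul_choose, Nat.descFactorial_eq_factorial_mul_choose,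
    ← Nat.choose_mul_factorial_mul_factorial (show i + 1 ≤ s + 1 by omega),
    show s + 1 - (i + 1) = s - i by omega]
  push_cast
  ring

variable [Algebra ℚ R]

theorem eq_zero_of_natCast_mul {n : ℕ} (hn : n ≠ 0) {x : R} (h : (n : R) * x = 0) : x = 0 := by
  have h1 : ((n : ℚ)⁻¹ * n) • x = 0 := by
    rw [mul_smul, Nat.cast_smul_eq_nsmul, nsmul_eq_mul, h, smul_zero]
  rwa [inv_mul_cancel₀ (by exact_mod_cast hn), one_smul] at h1

theorem natCast_mul_cancel {n : ℕ} (hn : n ≠ 0) {x y : R} (h : (n : R) * x = n * y) : x = y :=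
  sub_eq_zero.1 (eq_zero_of_natCast_mul hn (by rw [mul_sub, h, sub_self]))

theorem IsStuffle.mul_mul_S_eq_zero (hz : IsStuffle z)
    (h3 : ∀ i j l, prefixed z i [] * prefixed z j [] * prefixed z l [] = 0) (i j k s : ℕ)
    (hs : s ≠ 0) : prefixed z i [] * prefixed z j [] * S z k s = 0 := by
  refine eq_zero_of_natCast_mul hs ?_
  rw [mul_left_comm, hz.newton, Finset.mul_sum]
  refine Finset.sum_eq_zero fun a _ => ?_
  rw [mul_left_comm, Finset.mul_sum, Finset.sum_eq_zero, mul_zero]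
  intro x _
  rw [mul_left_comm, ← mul_assoc (prefixed z i [] * prefixed z j []), h3]
  simp

theorem IsStuffle.mul_S (hz : IsStuffle z)
    (h3 : ∀ i j l, prefixed z i [] * prefixed z j [] * prefixed z l [] = 0) (i k s : ℕ) :
    ((s + 1 : ℕ) : R) * (prefixed z i [] * S z k (s + 1))
      = (-1) ^ s * (numComp s k * (prefixed z i [] * prefixed z k [])) := by
  rw [mul_left_comm, hz.newton, Finset.sum_range_succ, mul_add, Finset.mul_sum,
    Finset.sum_eq_zero, zero_add]
  · rw [show s + 1 - 1 - s = 0 by omega, hz.sum_numComp_S_zero k s (fun j => prefixed z j [])]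
    ring
  · intro a ha
    rw [Finset.mem_range] at ha
    rw [mul_left_comm, Finset.mul_sum, Finset.sum_eq_zero, mul_zero]
    intro x _
    rw [mul_left_comm, ← mul_assoc (prefixed z i []), hz.mul_mul_S_eq_zero h3 _ _ _ _ (by omega),
      mul_zero]

/-- A sum over all indices is determined by the values in depth one, provided that triple products
of these vanish: only the contributions of at most two blocks survive. -/
theorem IsStuffle.S_eq (hz : IsStuffle z)
    (h3 : ∀ i j l, prefixed z i [] * prefixed z j [] * prefixed z l [] = 0) (w : ℕ → R)
    (hw : ∀ j, prefixed z j [] = j * w j) (k r : ℕ) (hr : 1 ≤ r) :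
    S z k r = (-1) ^ (r - 1) * (k.choose r : R) * w k
      + (-1) ^ r * ((1 / (r.factorial : ℚ)) • T (fun m => w (m - 1)) k r) := by
  obtain ⟨s, rfl⟩ : ∃ s, r = s + 1 := ⟨r - 1, by omega⟩
  rw [Nat.add_sub_cancel]
  have h1 : ∀ i ∈ Finset.range s, (-1 : R) ^ i * ∑ x ∈ antidiagonal k,
      (numComp i x.1 : R) * (prefixed z x.1 [] * S z x.2 (s + 1 - 1 - i))
        = (-1) ^ (s + 1) * (((i + 1 : ℕ) : R) * pairSum w k (i + 1) (s - i)) := by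
    intro i hi
    rw [Finset.mem_range] at hi
    obtain ⟨t, rfl⟩ : ∃ t, s = i + t + 1 := ⟨s - i - 1, by omega⟩
    rw [show i + t + 1 + 1 - 1 - i = t + 1 by omega, show i + t + 1 - i = t + 1 by omega]
    refine natCast_mul_cancel (n := t + 1) (by omega) ?_
    rw [mul_left_comm, Finset.mul_sum, pairSum, Finset.mul_sum, Finset.mul_sum, Finset.mul_sum,
      Finset.mul_sum]
    refine Finset.sum_congr rfl fun x _ => ?_
    rw [mul_left_comm ((t + 1 : ℕ) : R), hz.mul_S h3, hw, hw]
    have e1 := numComp_mul_cast (R := R) i x.1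
    have e2 := numComp_mul_cast (R := R) t x.2
    have e3 : (-1 : R) ^ (i + t + 1 + 1) = (-1) ^ i * (-1) ^ t := by
      rw [pow_succ, pow_succ, pow_add]
      ring
    rw [e3]
    linear_combination ((-1) ^ i * (-1) ^ t * w x.1 * w x.2 * (numComp t x.2) * (x.2 : R)) * e1
      + ((-1) ^ i * (-1) ^ t * w x.1 * w x.2 * ((i + 1 : ℕ) : R) * (x.1.choose (i + 1) : R)) * e2
  have h2 : 2 * ∑ i ∈ Finset.range s, ((i + 1 : ℕ) : R) * pairSum w k (i + 1) (s - i)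
      = ((s + 1 : ℕ) : R) * ∑ i ∈ Finset.range s, pairSum w k (i + 1) (s - i) := by
    rw [two_mul]
    nth_rewrite 2 [← Finset.sum_range_reflect]
    rw [← Finset.sum_add_distrib, Finset.mul_sum]
    refine Finset.sum_congr rfl fun i hi => ?_
    rw [Finset.mem_range] at hi
    rw [show s - 1 - i + 1 = s - i by omega, show s - (s - 1 - i) = i + 1 by omega,
      pairSum_comm w k (s - i), ← add_mul, ← Nat.cast_add, show i + 1 + (s - i) = s + 1 by omega]
  have hnewton := hz.newton k (s + 1)
  rw [Finset.sum_range_succ, Finset.sum_congr rfl h1, ← Finset.mul_sum,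
    show s + 1 - 1 - s = 0 by omega, hz.sum_numComp_S_zero k s (fun j => prefixed z j []), hw,
    ← mul_assoc (numComp s k : R), numComp_mul_cast] at hnewton
  have hT : 2 * ((1 / ((s + 1).factorial : ℚ)) • T (fun m => w (m - 1)) k (s + 1))
      = ∑ i ∈ Finset.range s, pairSum w k (i + 1) (s - i) := by
    rw [mul_smul_comm, two_mul_T_eq_pairSum, ← nsmul_eq_mul, ← Nat.cast_smul_eq_nsmul ℚ, smul_smul,
      one_div_mul_cancel (by exact_mod_cast Nat.factorial_ne_zero _), one_smul]
  refine natCast_mul_cancel (n := 2 * (s + 1)) (by omega) ?_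
  rw [Nat.cast_mul, Nat.cast_two]
  linear_combination 2 * hnewton + (-1) ^ (s + 1) * h2 - (-1) ^ (s + 1) * ((s + 1 : ℕ) : R) * hT

end SumFormula

end TwoBlocks

/-! ### Star values -/

section Star

variable {M : Type*} [AddCommGroup M]

/-- The value of `z` on the sum of all words obtained from `w` by adding up adjacent letters. -/
def starSum (z : Index → M) (w : Index) : M := ((merges w).map z).sum

/-- The functional `e_{c_1} e_{c_2} ⋯ ↦ z (e_{b + c_1} e_{c_2} ⋯)`, zero on the empty word. -/
def addFirst (b : ℕ+) (z : Index → M) : Index → M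
  | [] => 0
  | c :: u => z ((b + c) :: u)

theorem starSum_nil (z : Index → M) : starSum z [] = z [] := by simp [starSum, merges]

theorem sum_map_mergesFrom_add (b c : ℕ+) (v : Index) (z : Index → M) :
    ((mergesFrom (b + c) v).map z).sum = ((mergesFrom c v).map (addFirst b z)).sum := by
  induction v generalizing c with
  | nil => simp [mergesFrom, addFirst]
  | cons d v ih =>
    rw [mergesFrom, mergesFrom, List.map_append, List.map_append, List.sum_append, List.sum_append,
      add_assoc, ih, List.map_map, List.map_map]
    rfl

theorem starSum_cons (z : Index → M) (b : ℕ+) (v : Index) :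
    starSum z (b :: v) = starSum (fun u => z (b :: u)) v + starSum (addFirst b z) v := by
  cases v with
  | nil => simp [starSum, merges, mergesFrom, addFirst]
  | cons c v =>
    simp only [starSum, merges]
    rw [mergesFrom, List.map_append, List.sum_append, sum_map_mergesFrom_add, List.map_map]
    rfl

theorem starSum_add (y z : Index → M) (w : Index) :
    starSum (fun u => y u + z u) w = starSum y w + starSum z w := by
  simp [starSum, List.sum_map_add]

theorem starSum_neg (z : Index → M) (w : Index) :
    starSum (fun u => - z u) w = - starSum z w := by
  rw [starSum, starSum]
  induction merges w with
  | nil => simp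
  | cons u l ih => simp [ih, add_comm]

theorem starSum_sub (y z : Index → M) (w : Index) :
    starSum (fun u => y u - z u) w = starSum y w - starSum z w := by
  simp only [sub_eq_add_neg]
  rw [starSum_add, starSum_neg]

/-- The sum of `z` over all insertions of the letter `a` into a word. -/
def insertSum (a : ℕ+) : Index → (Index → M) → M
  | [], z => z [a]
  | b :: w, z => z (a :: b :: w) + insertSum a w (fun u => z (b :: u))

/-- The sum of `z` over all words obtained by adding `a` to a letter of a word. -/
def mergeSum (a : ℕ+) : Index → (Index → M) → M
  | [], _ => 0
  | b :: w, z => z ((a + b) :: w) + mergeSum a w (fun u => z (b :: u))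

theorem insertSum_add (a : ℕ+) (w : Index) (y z : Index → M) :
    insertSum a w (fun u => y u + z u) = insertSum a w y + insertSum a w z := by
  induction w generalizing y z with
  | nil => rfl
  | cons b w ih =>
    simp only [insertSum, ih]
    abel

theorem mergeSum_add (a : ℕ+) (w : Index) (y z : Index → M) :
    mergeSum a w (fun u => y u + z u) = mergeSum a w y + mergeSum a w z := by
  induction w generalizing y z with
  | nil => simp [mergeSum]
  | cons b w ih =>
    simp only [mergeSum, ih]
    abel

theorem stuffle_eq_insertSum_add_mergeSum (a : ℕ+) (w : Index) (z : Index → M) :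
    stuffle a w z = insertSum a w z + mergeSum a w z := by
  induction w generalizing z with
  | nil => simp [stuffle, insertSum, mergeSum]
  | cons b w ih =>
    simp only [stuffle, insertSum, mergeSum, ih]
    abel

theorem addFirst_stuffle (a b : ℕ+) (z : Index → M) :
    addFirst b (fun u => stuffle a u z) = fun u => addFirst b (fun v => z (a :: v)) u
      + stuffle a u (addFirst b z) - z ((a + b) :: u) := by
  funext u
  cases u with
  | nil => simp [addFirst, stuffle, add_comm]
  | cons c u =>
    simp only [addFirst, stuffle]
    rw [show b + (a + c) = a + (b + c) by rw [add_left_comm], add_comm b a]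
    abel

/-- In the harmonic product of a letter with a star word, the mergings enter with a negative sign. -/
theorem starSum_stuffle (a : ℕ+) (w : Index) (z : Index → M) :
    starSum (fun u => stuffle a u z) w
      = insertSum a w (starSum z) - mergeSum a w (starSum z) := by
  induction w generalizing z with
  | nil => simp [starSum_nil, starSum_cons, stuffle, insertSum, mergeSum, addFirst]
  | cons b v ih =>
    have h1 : (fun u => starSum z (b :: u))
        = fun u => starSum (fun t => z (b :: t)) u + starSum (addFirst b z) u :=
      funext fun u => starSum_cons z b u
    have h2 : (fun u => addFirst a z (b :: u)) = fun u => z ((a + b) :: u) := rfl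
    have h3 : addFirst b (addFirst a z) = addFirst (a + b) z := by
      funext u
      cases u with
      | nil => rfl
      | cons c u => simp [addFirst, add_assoc]
    rw [starSum_cons, addFirst_stuffle, starSum_sub, starSum_add, ih]
    simp only [stuffle, insertSum, mergeSum]
    rw [h1, insertSum_add, mergeSum_add, starSum_add, starSum_add, ih, starSum_cons z a,
      starSum_cons _ b, starSum_cons (addFirst a z) b, h2, h3, starSum_cons z (a + b)]
    abel

end Star

section Ring

variable {R : Type*} [CommRing R]

theorem starSum_mul_left (c : R) (z : Index → R) (w : Index) :
    starSum (fun u => c * z u) w = c * starSum z w := by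
  rw [starSum, starSum]
  induction merges w with
  | nil => simp
  | cons u l ih => simp [ih, mul_add]

theorem insertSum_signed (a : ℕ+) (w : Index) (c : R) (z : Index → R) :
    insertSum a w (fun u => c * (-1) ^ u.length * z u)
      = c * (-1) ^ (w.length + 1) * insertSum a w z := by
  induction w generalizing z c with
  | nil => simp [insertSum]
  | cons b w ih =>
    simp only [insertSum, List.length_cons]
    rw [show (fun u : Index => c * (-1) ^ (u.length + 1) * z (b :: u))
      = fun u : Index => (c * (-1)) * (-1) ^ u.length * z (b :: u) by
        funext u
        ring, ih]
    ring

theorem mergeSum_signed (a : ℕ+) (w : Index) (c : R) (z : Index → R) :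
    mergeSum a w (fun u => c * (-1) ^ u.length * z u)
      = c * (-1) ^ w.length * mergeSum a w z := by
  induction w generalizing z c with
  | nil => simp [mergeSum]
  | cons b w ih =>
    simp only [mergeSum, List.length_cons]
    rw [show (fun u : Index => c * (-1) ^ (u.length + 1) * z (b :: u))
      = fun u : Index => (c * (-1)) * (-1) ^ u.length * z (b :: u) by
        funext u
        ring, ih]
    ring

/-- The star values with the sign of the depth satisfy the same product rule as the values
themselves. -/
theorem IsStuffle.signed_starSum {z : Index → R} (hz : IsStuffle z) :
    IsStuffle (fun w => (-1) ^ w.length * starSum z w) where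
  nil := by simp [starSum_nil, hz.nil]
  mul a w := by
    have h := starSum_stuffle a w z
    rw [show (fun u => stuffle a u z) = fun u => z [a] * z u from
      funext fun u => (hz.mul a u).symm, starSum_mul_left] at h
    have h1 := insertSum_signed a w 1 (starSum z)
    have h2 := mergeSum_signed a w 1 (starSum z)
    simp only [one_mul] at h1 h2
    rw [stuffle_eq_insertSum_add_mergeSum, h1, h2, starSum_cons, starSum_nil, starSum_nil]
    simp only [List.length_cons, List.length_nil, addFirst]
    linear_combination (-1) ^ (w.length + 1) * h

theorem S_signed (y : Index → R) (k r : ℕ) :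
    S (fun w => (-1) ^ w.length * y w) k r = (-1) ^ r * S y k r := by
  rw [S, S, Finset.mul_sum]
  refine Finset.sum_congr rfl fun l hl => ?_
  rw [(mem_I.1 hl).2]

/-! ### The sum formulas in a nilpotent setting -/

variable [Algebra ℚ R] {z : Index → R} {𝔷 : ℕ → R} {x : R}

theorem T_eq_mul_T {y : ℕ → R} (c : R) (k r : ℕ)
    (h : ∀ i j, i + j = k → y (i + 1) * y (j + 1) = c * (𝔷 (i + 1) * 𝔷 (j + 1))) :
    T y k r = c * T 𝔷 k r := by
  refine natCast_mul_cancel (n := 2) (by norm_num) ?_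
  rw [Nat.cast_two, two_mul_T, mul_left_comm, two_mul_T, Finset.mul_sum]
  refine Finset.sum_congr rfl fun a _ => ?_
  rw [mul_left_comm]
  congr 1
  split_ifs
  · simp
  · rw [blockSum, blockSum, Finset.mul_sum]
    refine Finset.sum_congr rfl fun p hp => ?_
    have := h p.1 p.2 (mem_antidiagonal.1 hp)
    linear_combination ((p.1.descFactorial a : ℕ) : R) * ((p.2.descFactorial (r - a) : ℕ) : R)
      * this

/-- `IsStuffle.S_eq` and its analogue for star values. -/
theorem IsStuffle.S_eq_and_S_starSum_eq (hz : IsStuffle z) (w : ℕ → R)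
    (hw : ∀ a : ℕ+, z [a] = (a : ℕ) * w a) (h3 : ∀ i j l, w i * w j * w l = 0) (k r : ℕ)
    (hr : 1 ≤ r) :
    S z k r = (-1) ^ (r - 1) * (k.choose r : R) * w k
        + (-1) ^ r * ((1 / (r.factorial : ℚ)) • T (fun m => w (m - 1)) k r) ∧
      S (starSum z) k r = (k.choose r : R) * w k
        + (1 / (r.factorial : ℚ)) • T (fun m => w (m - 1)) k r := by
  have hp : ∀ j, prefixed z j [] = j * w j := by
    rintro (_ | j)
    · simp [prefixed]
    · simp [prefixed, hw]
  have hp' : ∀ j, prefixed (fun w => (-1) ^ w.length * starSum z w) j [] = j * (- w j) := by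
    rintro (_ | j)
    · simp [prefixed]
    · simp [prefixed, starSum_cons, starSum_nil, addFirst, hw]
  have hsq : ((-1 : R) ^ r) * (-1) ^ r = 1 := by rw [← mul_pow]; simp
  refine ⟨hz.S_eq (fun i j l => ?_) w hp k r hr, ?_⟩
  · rw [hp, hp, hp]
    linear_combination (i * j * l : R) * h3 i j l
  · have h := hz.signed_starSum.S_eq (fun i j l => ?_) (fun j => - w j) hp' k r hr
    · rw [S_signed, T_eq_mul_T (𝔷 := fun m => w (m - 1)) 1 k r (fun i j _ => by ring), one_mul] at h
      have e : (-1 : R) ^ r = (-1) ^ (r - 1) * (-1) := by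
        rw [← pow_succ, Nat.sub_add_cancel hr]
      linear_combination (-1) ^ r * h + ((1 / (r.factorial : ℚ)) • T (fun m => w (m - 1)) k r
        + (k.choose r : R) * w k - S (starSum z) k r) * hsq
        - (k.choose r : R) * w k * (-1) ^ r * e
    · rw [hp', hp', hp']
      linear_combination (-i * j * l : R) * h3 i j l

theorem IsStuffle.sum_formula_sq (hz : IsStuffle z) (hx : x ^ 2 = 0)
    (h : ∀ a : ℕ+, z [a] = (a : ℕ) * 𝔷 (a + 1) * x) (k r : ℕ) (hr : 1 ≤ r) :
    S z k r = (-1) ^ (r - 1) * (k.choose r : R) * 𝔷 (k + 1) * x ∧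
      S (starSum z) k r = (k.choose r : R) * 𝔷 (k + 1) * x := by
  have h2 := hz.S_eq_and_S_starSum_eq (fun j => 𝔷 (j + 1) * x) (fun a => by rw [h, mul_assoc])
    (fun i j l => by linear_combination (𝔷 (i + 1) * 𝔷 (j + 1) * 𝔷 (l + 1) * x) * hx) k r hr
  rw [T_eq_mul_T (𝔷 := 𝔷) 0 k r (fun i j _ => by
    simp only [Nat.add_sub_cancel]
    linear_combination 𝔷 (i + 1) * 𝔷 (j + 1) * hx)] at h2
  simpa [mul_assoc] using h2

theorem IsStuffle.sum_formula_cube (hz : IsStuffle z) (hx : x ^ 3 = 0)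
    (h : ∀ a : ℕ+, z [a] = (-1) ^ (a : ℕ) * ((a : ℕ) * 𝔷 (a + 1) * x
      + (((a : ℕ) + 1).choose 2 : R) * 𝔷 (a + 2) * x ^ 2)) (k r : ℕ) (hr : 1 ≤ r) :
    S z k r = (-1) ^ (k + r - 1) * ((k.choose r : R) * 𝔷 (k + 1) * x
        + ((((k : ℚ) + 1) / 2 * (k.choose r : ℚ)) • 𝔷 (k + 2)
          - (1 / (r.factorial : ℚ)) • T 𝔷 k r) * x ^ 2) ∧
      S (starSum z) k r = (-1) ^ k * ((k.choose r : R) * 𝔷 (k + 1) * x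
        + ((((k : ℚ) + 1) / 2 * (k.choose r : ℚ)) • 𝔷 (k + 2)
          + (1 / (r.factorial : ℚ)) • T 𝔷 k r) * x ^ 2) := by
  have hx4 : x ^ 4 = 0 := by rw [pow_succ, hx, zero_mul]
  set w : ℕ → R := fun j => (-1) ^ j * (𝔷 (j + 1) * x
    + (((j : ℚ) + 1) / 2) • (𝔷 (j + 2) * x ^ 2)) with hwdef
  have hwx : ∀ j, ∃ c, w j = x * c := fun j =>
    ⟨(-1) ^ j * (𝔷 (j + 1) + (((j : ℚ) + 1) / 2) • (𝔷 (j + 2) * x)), by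
      simp only [hwdef, Algebra.smul_def]
      ring⟩
  have hw : ∀ a : ℕ+, z [a] = (a : ℕ) * w a := by
    intro a
    have e : ((((a : ℕ) + 1).choose 2 : ℕ) : R)
        = (a : ℕ) * algebraMap ℚ R ((((a : ℕ) : ℚ) + 1) / 2) := by
      rw [← map_natCast (algebraMap ℚ R), ← map_natCast (algebraMap ℚ R) (a : ℕ), ← map_mul,
        Nat.cast_choose_two]
      congr 1
      push_cast
      ring
    rw [h, e]
    simp only [hwdef, Algebra.smul_def]
    ring
  have h2 := hz.S_eq_and_S_starSum_eq w hw (fun i j l => by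
    obtain ⟨a, ha⟩ := hwx i
    obtain ⟨b, hb⟩ := hwx j
    obtain ⟨c, hc⟩ := hwx l
    rw [ha, hb, hc]
    linear_combination (a * b * c) * hx) k r hr
  rw [T_eq_mul_T (𝔷 := 𝔷) ((-1) ^ k * x ^ 2) k r (fun i j hij => by
    simp only [Nat.add_sub_cancel, hwdef, Algebra.smul_def, ← hij, pow_add]
    linear_combination (-1) ^ i * (-1) ^ j * (𝔷 (i + 1) * 𝔷 (j + 2)
      * algebraMap ℚ R (((j : ℚ) + 1) / 2) + 𝔷 (j + 1) * 𝔷 (i + 2)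
      * algebraMap ℚ R (((i : ℚ) + 1) / 2)) * hx + (-1) ^ i * (-1) ^ j * (𝔷 (i + 2) * 𝔷 (j + 2)
      * algebraMap ℚ R (((j : ℚ) + 1) / 2) * algebraMap ℚ R (((i : ℚ) + 1) / 2)) * hx4)] at h2
  have e : (-1 : R) ^ (k + r - 1) = (-1) ^ k * (-1) ^ (r - 1) := by
    rw [← pow_add, Nat.add_sub_assoc hr]
  have e2 : (-1 : R) ^ r = (-1) ^ (r - 1) * (-1) := by
    rw [← pow_succ, Nat.sub_add_cancel hr]
  rw [h2.1, h2.2, e, e2]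
  simp only [hwdef, Algebra.smul_def, map_mul, map_natCast]
  constructor <;> ring

end Ring

/-! ### Truncated harmonic sums -/

theorem sum_piFinset_filter_cons {n : ℕ} {M : Type*} [AddCommMonoid M] (s : Finset ℕ)
    (s' : ℕ → Finset ℕ) (Q : (Fin (n + 1) → ℕ) → Prop) (P : (Fin n → ℕ) → Prop)
    [DecidablePred Q] [DecidablePred P]
    (h : ∀ a ∈ s, ∀ f : Fin n → ℕ, (∀ i, f i ∈ s) ∧ Q (Fin.cons a f) ↔ (∀ i, f i ∈ s' a) ∧ P f)
    (F : (Fin (n + 1) → ℕ) → M) :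
    ∑ f ∈ Fintype.piFinset (fun _ : Fin (n + 1) => s) with Q f, F f
      = ∑ a ∈ s, ∑ f ∈ Fintype.piFinset (fun _ : Fin n => s' a) with P f, F (Fin.cons a f) := by
  rw [Finset.sum_sigma']
  refine Finset.sum_bij' (fun f _ => ⟨f 0, Fin.tail f⟩) (fun x _ => Fin.cons x.1 x.2) ?_ ?_ ?_ ?_ ?_
  · intro f hf
    rw [Finset.mem_filter, Fintype.mem_piFinset] at hf
    rw [Finset.mem_sigma, Finset.mem_filter, Fintype.mem_piFinset]
    refine ⟨hf.1 0, (h _ (hf.1 0) _).1 ⟨fun i => hf.1 i.succ, ?_⟩⟩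
    rw [Fin.cons_self_tail]
    exact hf.2
  · rintro ⟨a, f⟩ hx
    rw [Finset.mem_sigma, Finset.mem_filter, Fintype.mem_piFinset] at hx
    rw [Finset.mem_filter, Fintype.mem_piFinset]
    have := (h a hx.1 f).2 hx.2
    refine ⟨fun i => ?_, this.2⟩
    refine Fin.cases ?_ (fun i => ?_) i
    · exact hx.1
    · exact this.1 i
  · intro f _
    exact Fin.cons_self_tail f
  · rintro ⟨a, f⟩ _
    rfl
  · intro f _
    rw [Fin.cons_self_tail]

/-- `∑_{m ≤ n_1 < ⋯ < n_r < p} 1 / (n_1^{k_1} ⋯ n_r^{k_r})`. -/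
def harmonicFrom (p : ℕ) : ℕ → Index → ℚ
  | _, [] => 1
  | m, b :: w => ∑ n ∈ Finset.Ico m p, 1 / (n : ℚ) ^ (b : ℕ) * harmonicFrom p (n + 1) w

/-- `∑_{m ≤ n_1 ≤ ⋯ ≤ n_r < p} 1 / (n_1^{k_1} ⋯ n_r^{k_r})`. -/
def harmonicStarFrom (p : ℕ) : ℕ → Index → ℚ
  | _, [] => 1
  | m, b :: w => ∑ n ∈ Finset.Ico m p, 1 / (n : ℚ) ^ (b : ℕ) * harmonicStarFrom p n w

open Classical in
theorem sum_strictMono_eq_harmonicFrom (p m : ℕ) (w : Index) :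
    ∑ f ∈ Fintype.piFinset (fun _ : Fin w.length => Finset.Ico m p) with StrictMono f,
      ∏ i, 1 / (f i : ℚ) ^ (w.get i : ℕ) = harmonicFrom p m w := by
  induction w generalizing m with
  | nil =>
    rw [Finset.filter_true_of_mem (fun f _ i => i.elim0), harmonicFrom]
    simp
  | cons b w ih =>
    refine (sum_piFinset_filter_cons (n := w.length) (Finset.Ico m p)
      (fun a => Finset.Ico (a + 1) p) _ (fun f => StrictMono f) ?_ _).trans ?_
    · intro a ha f
      rw [Fin.strictMono_cons]
      rw [Finset.mem_Ico] at ha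
      simp only [Finset.mem_Ico]
      constructor
      · rintro ⟨h1, h2, h3⟩
        exact ⟨fun i => ⟨h2 i, (h1 i).2⟩, h3⟩
      · rintro ⟨h1, h2⟩
        exact ⟨fun i => ⟨by have := h1 i; omega, (h1 i).2⟩, fun i => (h1 i).1, h2⟩
    · rw [harmonicFrom]
      refine Finset.sum_congr rfl fun n _ => ?_
      rw [← ih, Finset.mul_sum]
      exact Finset.sum_congr rfl fun f _ => Fin.prod_univ_succ _

theorem monotone_fin_cons {n a : ℕ} {f : Fin n → ℕ} :
    Monotone (Fin.cons a f : Fin (n + 1) → ℕ) ↔ (∀ j, a ≤ f j) ∧ Monotone f := by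
  rw [monotone_iff_forall_lt, monotone_iff_forall_lt]
  exact Fin.liftFun_cons (· ≤ ·)

open Classical in
theorem sum_monotone_eq_harmonicStarFrom (p m : ℕ) (w : Index) :
    ∑ f ∈ Fintype.piFinset (fun _ : Fin w.length => Finset.Ico m p) with Monotone f,
      ∏ i, 1 / (f i : ℚ) ^ (w.get i : ℕ) = harmonicStarFrom p m w := by
  induction w generalizing m with
  | nil =>
    rw [Finset.filter_true_of_mem (fun f _ i => i.elim0), harmonicStarFrom]
    simp
  | cons b w ih =>
    refine (sum_piFinset_filter_cons (n := w.length) (Finset.Ico m p)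
      (fun a => Finset.Ico a p) _ (fun f => Monotone f) ?_ _).trans ?_
    · intro a ha f
      rw [monotone_fin_cons]
      rw [Finset.mem_Ico] at ha
      simp only [Finset.mem_Ico]
      constructor
      · rintro ⟨h1, h2, h3⟩
        exact ⟨fun i => ⟨h2 i, (h1 i).2⟩, h3⟩
      · rintro ⟨h1, h2⟩
        exact ⟨fun i => ⟨by have := h1 i; omega, (h1 i).2⟩, fun i => (h1 i).1, h2⟩
    · rw [harmonicStarFrom]
      refine Finset.sum_congr rfl fun n _ => ?_
      rw [← ih, Finset.mul_sum]
      exact Finset.sum_congr rfl fun f _ => Fin.prod_univ_succ _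

theorem harmonicSum_eq_harmonicFrom (p : ℕ) (w : Index) :
    harmonicSum p w = harmonicFrom p 1 w :=
  sum_strictMono_eq_harmonicFrom p 1 w

theorem harmonicStarSum_eq_harmonicStarFrom (p : ℕ) (w : Index) :
    harmonicStarSum p w = harmonicStarFrom p 1 w :=
  sum_monotone_eq_harmonicStarFrom p 1 w

theorem isStuffle_harmonicFrom (p m : ℕ) : IsStuffle (harmonicFrom p m) where
  nil := by rw [harmonicFrom]
  mul a w := by
    induction w generalizing m with
    | nil => simp [harmonicFrom, stuffle]
    | cons b w ih =>
      have e1 : ∀ n, harmonicFrom p n [a] = ∑ i ∈ Finset.Ico n p, 1 / (i : ℚ) ^ (a : ℕ) := by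
        intro n
        simp [harmonicFrom]
      have e2 : (fun u => harmonicFrom p m (b :: u)) = fun u => ∑ n ∈ Finset.Ico m p,
          1 / (n : ℚ) ^ (b : ℕ) * harmonicFrom p (n + 1) u := by
        funext u
        rw [harmonicFrom]
      rw [stuffle, e2, stuffle_sum, e1, harmonicFrom, harmonicFrom, harmonicFrom, Finset.mul_sum]
      simp only [stuffle_mul_left, ← ih, harmonicFrom, Finset.mul_sum]
      rw [Finset.sum_Ico_Ico_comm', ← Finset.sum_add_distrib, ← Finset.sum_add_distrib]
      refine Finset.sum_congr rfl fun n hn => ?_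
      rw [Finset.mem_Ico] at hn
      rw [← Finset.sum_mul, ← Finset.sum_Ico_consecutive _ hn.1 hn.2.le,
        Finset.sum_eq_sum_Ico_succ_bot hn.2, PNat.add_coe, pow_add]
      simp only [mul_one]
      rw [← one_div_mul_one_div]
      ring

theorem starSum_sum {ι M : Type*} [AddCommGroup M] (s : Finset ι) (z : ι → Index → M) (w : Index) :
    starSum (fun u => ∑ i ∈ s, z i u) w = ∑ i ∈ s, starSum (z i) w := by
  classical
  induction s using Finset.induction_on with
  | empty => simp [starSum]
  | insert i s hi ih => simp [Finset.sum_insert hi, starSum_add, ih]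

/-- A weakly increasing tuple is a strictly increasing one with multiplicities. -/
theorem harmonicStarFrom_eq_starSum (p m : ℕ) (w : Index) :
    harmonicStarFrom p m w = starSum (harmonicFrom p m) w := by
  induction w generalizing m with
  | nil => rw [starSum_nil, harmonicStarFrom, harmonicFrom]
  | cons b w ih =>
    have h : (fun u => harmonicFrom p m (b :: u) + addFirst b (harmonicFrom p m) u)
        = fun u => ∑ n ∈ Finset.Ico m p, 1 / (n : ℚ) ^ (b : ℕ) * harmonicFrom p n u := by
      funext u
      cases u with
      | nil => simp [addFirst, harmonicFrom]
      | cons c u =>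
        rw [harmonicFrom, addFirst, harmonicFrom, ← Finset.sum_add_distrib]
        refine Finset.sum_congr rfl fun n hn => ?_
        rw [Finset.mem_Ico] at hn
        rw [harmonicFrom, harmonicFrom, Finset.sum_eq_sum_Ico_succ_bot hn.2, PNat.add_coe, pow_add]
        field_simp
        ring
    rw [starSum_cons, ← starSum_add, h, starSum_sum, harmonicStarFrom]
    refine Finset.sum_congr rfl fun n _ => ?_
    rw [ih, starSum_mul_left]

/-! ### Rational numbers with denominator prime to `p` -/

/-- The subring of rational numbers whose denominator is prime to `p`. -/
def intAt (p : ℕ) : Subring ℚ where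
  carrier := {q | q.den.Coprime p}
  mul_mem' {a b} ha hb := Nat.Coprime.of_dvd_left (Rat.mul_den_dvd a b) (ha.mul_left hb)
  one_mem' := by simp
  add_mem' {a b} ha hb := Nat.Coprime.of_dvd_left (Rat.add_den_dvd a b) (ha.mul_left hb)
  zero_mem' := by simp
  neg_mem' {a} ha := by simpa using ha

theorem mem_intAt {p : ℕ} {q : ℚ} : q ∈ intAt p ↔ q.den.Coprime p := Iff.rfl

theorem inv_natCast_mem_intAt {p n : ℕ} (h : n.Coprime p) : (n : ℚ)⁻¹ ∈ intAt p := by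
  rw [mem_intAt, Rat.inv_natCast_den]
  split_ifs
  · simp
  · exact h

theorem isUnit_den {p : ℕ} (n : ℕ) {q : ℚ} (h : q ∈ intAt p) : IsUnit (q.den : ZMod (p ^ n)) :=
  (ZMod.isUnit_iff_coprime _ _).2 (Nat.Coprime.pow_right n h)

theorem ratMod_mul_den {p : ℕ} (n : ℕ) {q : ℚ} (h : q ∈ intAt p) :
    ratMod (p ^ n) q * (q.den : ZMod (p ^ n)) = (q.num : ZMod (p ^ n)) := by
  rw [ratMod, mul_assoc, ZMod.inv_mul_of_unit _ (isUnit_den n h), mul_one]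

/-- Reduction modulo `p ^ n` as a ring homomorphism. -/
def ratModHom (p n : ℕ) : intAt p →+* ZMod (p ^ n) where
  toFun q := ratMod (p ^ n) q
  map_one' := by simp [ratMod]
  map_zero' := by simp [ratMod]
  map_mul' := by
    rintro ⟨a, ha⟩ ⟨b, hb⟩
    have hab := mul_mem ha hb
    refine ((isUnit_den n hab).mul ((isUnit_den n ha).mul (isUnit_den n hb))).mul_right_cancel ?_
    have h := congrArg (Int.cast : ℤ → ZMod (p ^ n)) (Rat.mul_num_den' a b)
    push_cast at h
    have h1 := ratMod_mul_den n ha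
    have h2 := ratMod_mul_den n hb
    have h3 := ratMod_mul_den n hab
    change ratMod (p ^ n) (a * b) * _ = ratMod (p ^ n) a * ratMod (p ^ n) b * _
    rw [← h1, ← h2, ← h3] at h
    linear_combination h
  map_add' := by
    rintro ⟨a, ha⟩ ⟨b, hb⟩
    have hab := add_mem ha hb
    refine ((isUnit_den n hab).mul ((isUnit_den n ha).mul (isUnit_den n hb))).mul_right_cancel ?_
    have h := congrArg (Int.cast : ℤ → ZMod (p ^ n)) (Rat.add_num_den' a b)
    push_cast at h
    have h1 := ratMod_mul_den n ha
    have h2 := ratMod_mul_den n hb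
    have h3 := ratMod_mul_den n hab
    change ratMod (p ^ n) (a + b) * _ = (ratMod (p ^ n) a + ratMod (p ^ n) b) * _
    rw [← h1, ← h2, ← h3] at h
    linear_combination h

theorem harmonicFrom_mem_intAt {p : ℕ} (hp : p.Prime) {m : ℕ} (hm : 1 ≤ m) (w : Index) :
    harmonicFrom p m w ∈ intAt p := by
  induction w generalizing m with
  | nil => exact one_mem _
  | cons b w ih =>
    rw [harmonicFrom]
    refine sum_mem fun n hn => mul_mem ?_ (ih (by omega))
    rw [Finset.mem_Ico] at hn
    rw [one_div, ← inv_pow]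
    exact pow_mem (inv_natCast_mem_intAt
      (Nat.coprime_of_lt_prime (by omega) hn.2 hp).symm) _

/-! ### The product rule in `A_n` -/

theorem map_starSum {M N : Type*} [AddCommGroup M] [AddCommGroup N] (f : M →+ N) (z : Index → M)
    (w : Index) : f (starSum z w) = starSum (fun u => f (z u)) w := by
  rw [starSum, starSum, map_list_sum, List.map_map]
  rfl

/-- The truncated harmonic sums as elements of `intAt p`. -/
def harmonicInt (p : Nat.Primes) (w : Index) : intAt p :=
  ⟨harmonicFrom p 1 w, harmonicFrom_mem_intAt p.2 le_rfl w⟩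

theorem isStuffle_harmonicInt (p : Nat.Primes) : IsStuffle (harmonicInt p) where
  nil := Subtype.ext (isStuffle_harmonicFrom p 1).nil
  mul a w := Subtype.ext <| ((isStuffle_harmonicFrom p 1).mul a w).trans
    (map_stuffle (intAt p).subtype.toAddMonoidHom a w (harmonicInt p)).symm

theorem zetaA_eq (n : ℕ) (w : Index) :
    zetaA n w = ARing.mk n fun p => ratModHom p n (harmonicInt p w) := by
  rw [zetaA]
  congr 1
  funext p
  rw [harmonicSum_eq_harmonicFrom]
  rfl

theorem isStuffle_zetaA (n : ℕ) : IsStuffle (zetaA n) := by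
  have h : IsStuffle (fun w => (fun p : Nat.Primes => ratModHom p n (harmonicInt p w))) :=
    { nil := by
        funext p
        exact ((isStuffle_harmonicInt p).map (ratModHom p n)).nil
      mul := by
        intro a w
        funext p
        exact (((isStuffle_harmonicInt p).map (ratModHom p n)).mul a w).trans
          (map_stuffle (Pi.evalAddMonoidHom (fun p : Nat.Primes => ZMod ((p : ℕ) ^ n)) p) a w
            (fun w => (fun p : Nat.Primes => ratModHom p n (harmonicInt p w)))).symm }
  rw [show zetaA n = _ from funext (zetaA_eq n)]
  exact h.map (Ideal.Quotient.mk (finSuppIdeal n))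

theorem zetaAStar_eq_starSum (n : ℕ) : zetaAStar n = starSum (zetaA n) := by
  funext w
  rw [show zetaA n = _ from funext (zetaA_eq n)]
  refine Eq.trans ?_ (map_starSum (Ideal.Quotient.mk (finSuppIdeal n)).toAddMonoidHom
    (fun w => (fun p : Nat.Primes => ratModHom p n (harmonicInt p w))) w)
  rw [zetaAStar]
  refine congrArg (ARing.mk n) ?_
  funext p
  refine Eq.trans ?_ (map_starSum (Pi.evalAddMonoidHom
    (fun p : Nat.Primes => ZMod ((p : ℕ) ^ n)) p) _ w).symm
  refine Eq.trans ?_ (map_starSum (ratModHom p n).toAddMonoidHom (harmonicInt p) w)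
  change _ = ratMod _ _
  congr 1
  rw [harmonicStarSum_eq_harmonicStarFrom, harmonicStarFrom_eq_starSum]
  exact (map_starSum (intAt p).subtype.toAddMonoidHom (harmonicInt p) w).symm

theorem ARing.mk_eq_mk {n : ℕ} {a b : ∀ p : Nat.Primes, ZMod ((p : ℕ) ^ n)} (N : ℕ)
    (h : ∀ p : Nat.Primes, N < p → a p = b p) : ARing.mk n a = ARing.mk n b := by
  refine Ideal.Quotient.eq.2 ?_
  have hfin : ((fun p : Nat.Primes => (p : ℕ)) ⁻¹' Set.Iic N).Finite :=
    (Set.finite_Iic N).preimage (fun a _ b _ hab => Subtype.ext hab)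
  refine hfin.subset fun p hp => ?_
  by_contra hlt
  exact hp (sub_eq_zero.2 (h p (not_le.mp hlt)))

theorem xA_pow (n : ℕ) : xA n ^ n = 0 := by
  change Ideal.Quotient.mk (finSuppIdeal n) _ ^ n = 0
  rw [← map_pow]
  refine (congrArg _ ?_).trans (map_zero _)
  funext p
  change ((p : ℕ) : ZMod ((p : ℕ) ^ n)) ^ n = 0
  rw [← Nat.cast_pow, ZMod.natCast_self]

/-! ### Power sums modulo powers of `p` and Bernoulli numbers -/

theorem inv_two_mem_intAt {p : ℕ} (hp : p.Prime) (hp2 : p ≠ 2) : (2 : ℚ)⁻¹ ∈ intAt p := by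
  have := inv_natCast_mem_intAt ((Nat.coprime_primes Nat.prime_two hp).2 hp2.symm)
  exact_mod_cast this

/-- The `p`-part of the von Staudt-Clausen theorem: up to a `p`-integral number, `B_m` is `0` or
`-1 / p`, and the latter occurs only if `p - 1` divides `m`. -/
theorem exists_bernoulli_add_eq {p : ℕ} (hp : p.Prime) (hp2 : p ≠ 2) (m : ℕ) :
    ∃ c ∈ intAt p, bernoulli m = c - (if (p - 1) ∣ m then 1 / (p : ℚ) else 0) ∨
      bernoulli m = c := by
  rcases Nat.even_or_odd' m with ⟨k, rfl | rfl⟩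
  · obtain ⟨n, hn⟩ := Bernoulli.vonStaudt_clausen k
    by_cases hk : p ∈ (Finset.range (2 * k + 2)).filter (fun q => q.Prime ∧ (q - 1) ∣ 2 * k)
    · rw [← Finset.add_sum_erase _ _ hk] at hn
      refine ⟨n - ∑ q ∈ ((Finset.range (2 * k + 2)).filter
        (fun q => q.Prime ∧ (q - 1) ∣ 2 * k)).erase p, 1 / (q : ℚ), sub_mem (intCast_mem _ n)
          (sum_mem fun q hq => ?_), Or.inl ?_⟩
      · rw [Finset.mem_erase, Finset.mem_filter] at hq
        rw [one_div]
        exact inv_natCast_mem_intAt ((Nat.coprime_primes hq.2.2.1 hp).2 hq.1)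
      · rw [if_pos (Finset.mem_filter.1 hk).2.2]
        linear_combination -hn
    · refine ⟨n - ∑ q ∈ (Finset.range (2 * k + 2)).filter
        (fun q => q.Prime ∧ (q - 1) ∣ 2 * k), 1 / (q : ℚ), sub_mem (intCast_mem _ n)
          (sum_mem fun q hq => ?_), Or.inr ?_⟩
      · have hne : q ≠ p := by
          rintro rfl
          exact hk hq
        rw [Finset.mem_filter] at hq
        rw [one_div]
        exact inv_natCast_mem_intAt ((Nat.coprime_primes hq.2.1 hp).2 hne)
      · linear_combination -hn
  · rcases Nat.eq_zero_or_pos k with rfl | hk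
    · refine ⟨_, ?_, Or.inr rfl⟩
      rw [mul_zero, zero_add, bernoulli_one, div_eq_mul_inv]
      exact mul_mem (neg_mem (one_mem _)) (inv_two_mem_intAt hp hp2)
    · exact ⟨0, zero_mem _, Or.inr (bernoulli_eq_zero_of_odd ⟨k, rfl⟩ (by omega))⟩

theorem bernoulli_mem_intAt {p : ℕ} (hp : p.Prime) (hp2 : p ≠ 2) {m : ℕ} (h : ¬ (p - 1) ∣ m) :
    bernoulli m ∈ intAt p := by
  obtain ⟨c, hc, h1 | h1⟩ := exists_bernoulli_add_eq hp hp2 m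
  · rw [h1, if_neg h, sub_zero]
    exact hc
  · rw [h1]
    exact hc

theorem mul_bernoulli_mem_intAt {p : ℕ} (hp : p.Prime) (hp2 : p ≠ 2) (m : ℕ) :
    (p : ℚ) * bernoulli m ∈ intAt p := by
  obtain ⟨c, hc, h1 | h1⟩ := exists_bernoulli_add_eq hp hp2 m
  · rw [h1, mul_sub]
    refine sub_mem (mul_mem (natCast_mem _ p) hc) ?_
    split_ifs
    · rw [mul_one_div_cancel (by exact_mod_cast hp.ne_zero)]
      exact one_mem _
    · simp
  · rw [h1]
    exact mul_mem (natCast_mem _ p) hc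

/-- The terms of degree at least `4` in Faulhaber's formula are divisible by `p ^ 3`. -/
theorem pow_div_mem_intAt {p : ℕ} (hp : p.Prime) (hp5 : 5 ≤ p) (j : ℕ) :
    (p : ℚ) ^ j / ((j + 4 : ℕ) : ℚ) ∈ intAt p := by
  obtain ⟨v, u, hu, hv⟩ := Nat.exists_eq_pow_mul_and_not_dvd (n := j + 4) (by omega) p hp.ne_one
  have hvj : v ≤ j := by
    by_contra hlt
    have h1 : p ^ (j + 1) ≤ p ^ v := Nat.pow_le_pow_right hp.pos (by omega)
    have h2 : p ^ v ≤ j + 4 := Nat.le_of_dvd (by omega) ⟨u, hv⟩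
    have h3 : 5 ^ (j + 1) ≤ p ^ (j + 1) := Nat.pow_le_pow_left hp5 _
    have h4 : j + 4 < 5 ^ (j + 1) := by
      clear * -
      induction j with
      | zero => norm_num
      | succ j ih =>
        rw [pow_succ]
        omega
    omega
  have hp0 : (p : ℚ) ≠ 0 := by exact_mod_cast hp.ne_zero
  have hu0 : (u : ℚ) ≠ 0 := by
    rintro h
    rw [Nat.cast_eq_zero] at h
    subst h
    omega
  have e : (p : ℚ) ^ j / ((j + 4 : ℕ) : ℚ) = (p : ℚ) ^ (j - v) * (u : ℚ)⁻¹ := by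
    rw [hv]
    push_cast
    rw [pow_sub₀ _ hp0 hvj]
    field_simp
  rw [e]
  exact mul_mem (pow_mem (natCast_mem _ p) _)
    (inv_natCast_mem_intAt ((Nat.Prime.coprime_iff_not_dvd hp).2 hu).symm)

theorem faulhaber_reflected (p M : ℕ) :
    ∑ n ∈ Finset.range p, (n : ℚ) ^ M = ∑ j ∈ Finset.range (M + 1),
      bernoulli (M - j) * (M.choose j : ℚ) * (p : ℚ) ^ (j + 1) / ((j + 1 : ℕ) : ℚ) := by
  rw [sum_range_pow, ← Finset.sum_range_reflect]
  refine Finset.sum_congr rfl fun j hj => ?_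
  rw [Finset.mem_range] at hj
  have hj' : j ≤ M := by omega
  rw [show M + 1 - 1 - j = M - j by omega, show M + 1 - (M - j) = j + 1 by omega,
    Nat.choose_symm_of_eq_add (show M + 1 = (M - j) + (j + 1) by omega)]
  have h := congrArg (Nat.cast : ℕ → ℚ) (Nat.add_one_mul_choose_eq M j)
  push_cast at h ⊢
  rw [div_eq_div_iff (by positivity) (by positivity)]
  linear_combination (-bernoulli (M - j) * (p : ℚ) ^ (j + 1)) * h

/-- The power sum `∑_{n < p} n ^ M` modulo `p ^ 3`. -/
theorem exists_sum_pow_eq {p : ℕ} (hp : p.Prime) (hp5 : 5 ≤ p) {M : ℕ} (hM : 2 ≤ M)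
    (h2 : ¬ (p - 1) ∣ M - 2) : ∃ c ∈ intAt p, ∑ n ∈ Finset.range p, (n : ℚ) ^ M
      = p * bernoulli M + M / 2 * (p : ℚ) ^ 2 * bernoulli (M - 1) + (p : ℚ) ^ 3 * c := by
  have hp2 : p ≠ 2 := by omega
  obtain ⟨N, rfl⟩ : ∃ N, M = N + 2 := ⟨M - 2, by omega⟩
  rw [Nat.add_sub_cancel] at h2
  refine ⟨bernoulli N * ((N + 2).choose 2 : ℚ) * ((3 : ℕ) : ℚ)⁻¹ + ∑ j ∈ Finset.range N,
    (p * bernoulli (N + 2 - (j + 3))) * ((N + 2).choose (j + 3) : ℚ)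
      * ((p : ℚ) ^ j / ((j + 4 : ℕ) : ℚ)), add_mem (mul_mem (mul_mem
        (bernoulli_mem_intAt hp hp2 h2) (natCast_mem _ _)) (inv_natCast_mem_intAt
        ((Nat.coprime_primes Nat.prime_three hp).2 (by omega))))
        (sum_mem fun j _ => mul_mem (mul_mem (mul_bernoulli_mem_intAt hp hp2 _)
          (natCast_mem _ _)) (pow_div_mem_intAt hp hp5 j)), ?_⟩
  rw [faulhaber_reflected, Finset.sum_range_succ', Finset.sum_range_succ', Finset.sum_range_succ',
    mul_add, Finset.mul_sum]
  have e : ∀ j ∈ Finset.range N, bernoulli (N + 2 - (j + 1 + 1 + 1))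
      * ((N + 2).choose (j + 1 + 1 + 1) : ℚ) * (p : ℚ) ^ (j + 1 + 1 + 1 + 1)
        / ((j + 1 + 1 + 1 + 1 : ℕ) : ℚ) = (p : ℚ) ^ 3 * ((p * bernoulli (N + 2 - (j + 3)))
        * ((N + 2).choose (j + 3) : ℚ) * ((p : ℚ) ^ j / ((j + 4 : ℕ) : ℚ))) := by
    intro j _
    ring
  rw [Finset.sum_congr rfl e]
  have e1 : N + 2 - (0 + 1 + 1) = N := by omega
  have e2 : N + 2 - (0 + 1) = N + 2 - 1 := by omega
  rw [e1, e2]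
  simp only [zero_add, Nat.choose_one_right, Nat.choose_zero_right, Nat.sub_zero]
  push_cast
  ring

/-- By Euler's theorem, `∑_{0 < n < p} n ^ (-k)` is congruent modulo `p ^ e` to a sum of positive
powers, which Faulhaber's formula expresses in Bernoulli numbers. -/
theorem exists_harmonicFrom_eq {p : ℕ} (hp : p.Prime) {a : ℕ+} (hpa : (a : ℕ) + 4 < p) {e : ℕ}
    (he : 1 ≤ e) (he3 : e ≤ 3) {M : ℕ} (hM : M + a = p ^ (e - 1) * (p - 1)) :
    ∃ c ∈ intAt p, harmonicFrom p 1 [a]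
      = p * bernoulli M + M / 2 * (p : ℚ) ^ 2 * bernoulli (M - 1) + (p : ℚ) ^ e * c := by
  have ha := a.pos
  have hMp : p - 1 ≤ M + a := by
    rw [hM]
    exact Nat.le_mul_of_pos_left _ (pow_pos hp.pos _)
  have hdvd : ¬ (p - 1) ∣ M - 2 := by
    intro h
    have h1 : (p - 1) ∣ (M - 2) + (a + 2) := by
      rw [show M - 2 + (a + 2) = M + a by omega, hM]
      exact dvd_mul_left _ _
    have h2 := (Nat.dvd_add_right h).1 h1
    exact absurd (Nat.le_of_dvd (by omega) h2) (by omega)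
  obtain ⟨c, hc, h⟩ := exists_sum_pow_eq hp (by omega) (M := M) (by omega) hdvd
  have h1 : ∀ n ∈ Finset.Ico 1 p, ∃ d ∈ intAt p,
      1 / (n : ℚ) ^ (a : ℕ) = (n : ℚ) ^ M + (p : ℚ) ^ e * d := by
    intro n hn
    rw [Finset.mem_Ico] at hn
    have hcop : n.Coprime p := (Nat.coprime_of_lt_prime (by omega) hn.2 hp).symm
    have h2 := Nat.ModEq.pow_totient (Nat.Coprime.pow_right e hcop)
    rw [Nat.totient_prime_pow hp (by omega), ← hM] at h2
    obtain ⟨t, ht⟩ := (Nat.modEq_iff_dvd.1 h2)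
    have hn0 : (n : ℚ) ≠ 0 := by exact_mod_cast (by omega : n ≠ 0)
    refine ⟨t * ((n : ℚ)⁻¹) ^ (a : ℕ), mul_mem (intCast_mem _ t)
      (pow_mem (inv_natCast_mem_intAt hcop) _), ?_⟩
    have ht' := congrArg (Int.cast : ℤ → ℚ) ht
    push_cast at ht'
    rw [pow_add] at ht'
    rw [inv_pow, one_div]
    have hna : ((n : ℚ) ^ (a : ℕ)) * ((n : ℚ) ^ (a : ℕ))⁻¹ = 1 :=
      mul_inv_cancel₀ (pow_ne_zero _ hn0)
    linear_combination ((n : ℚ) ^ (a : ℕ))⁻¹ * ht' + (n : ℚ) ^ M * hna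
  choose! d hd h1 using h1
  refine ⟨∑ n ∈ Finset.Ico 1 p, d n + (p : ℚ) ^ (3 - e) * c, add_mem (sum_mem fun n hn => hd n hn)
    (mul_mem (pow_mem (natCast_mem _ _) _) hc), ?_⟩
  have e1 : harmonicFrom p 1 [a] = ∑ n ∈ Finset.Ico 1 p, 1 / (n : ℚ) ^ (a : ℕ) := by
    simp [harmonicFrom]
  have e2 : ∑ n ∈ Finset.range p, (n : ℚ) ^ M = ∑ n ∈ Finset.Ico 1 p, (n : ℚ) ^ M := by
    rw [Finset.range_eq_Ico, Finset.sum_eq_sum_Ico_succ_bot hp.pos]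
    have : M ≠ 0 := by omega
    simp [this]
  have e3 : (p : ℚ) ^ e * (p : ℚ) ^ (3 - e) = (p : ℚ) ^ 3 := by
    rw [← pow_add, Nat.add_sub_of_le he3]
  rw [e1, Finset.sum_congr rfl h1, Finset.sum_add_distrib, ← Finset.mul_sum, ← e2, h]
  linear_combination -c * e3

/-- The rational number whose residues modulo `p ^ e` are the components of `frakZA e m`. -/
def frakZRat (e m p : ℕ) : ℚ :=
  bernoulli (p ^ (e - 1) * (p - 1) + 1 - m) / ((m : ℚ) - 1 + (p : ℚ) ^ (e - 1))

theorem not_dvd_of_add_eq {p e M b : ℕ} (hb : 0 < b) (hbp : b + 1 < p)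
    (h : M + b = p ^ (e - 1) * (p - 1)) : ¬ (p - 1) ∣ M := by
  intro hd
  have h1 : (p - 1) ∣ M + b := h ▸ dvd_mul_left _ _
  exact absurd (Nat.le_of_dvd hb ((Nat.dvd_add_right hd).1 h1)) (by omega)

theorem frakZRat_eq {p e M b : ℕ} (h : M + b = p ^ (e - 1) * (p - 1)) :
    frakZRat e (b + 1) p = bernoulli M * (((b + p ^ (e - 1) : ℕ) : ℚ))⁻¹ := by
  rw [frakZRat, show p ^ (e - 1) * (p - 1) + 1 - (b + 1) = M by omega, div_eq_mul_inv]
  congr 2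
  push_cast
  ring

theorem inv_add_pow_mem_intAt {p e b : ℕ} (hp : p.Prime) (he : 2 ≤ e) (hb : 0 < b)
    (hbp : b + 1 < p) : (((b + p ^ (e - 1) : ℕ) : ℚ))⁻¹ ∈ intAt p := by
  obtain ⟨f, rfl⟩ : ∃ f, e = f + 2 := ⟨e - 2, by omega⟩
  refine inv_natCast_mem_intAt ?_
  rw [show f + 2 - 1 = f + 1 by omega, pow_succ, Nat.coprime_add_mul_right_left]
  exact (Nat.coprime_of_lt_prime (by omega) (by omega) hp).symm

theorem frakZRat_mem_intAt {p e M b : ℕ} (hp : p.Prime) (he : 2 ≤ e) (hb : 0 < b)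
    (hbp : b + 1 < p) (h : M + b = p ^ (e - 1) * (p - 1)) : frakZRat e (b + 1) p ∈ intAt p := by
  rw [frakZRat_eq h]
  have hp2 : p ≠ 2 := by omega
  exact mul_mem (bernoulli_mem_intAt hp hp2 (not_dvd_of_add_eq hb hbp h))
    (inv_add_pow_mem_intAt hp he hb hbp)

theorem natCast_pow_self_eq_zero (p n : ℕ) : ((p : ℕ) : ZMod (p ^ n)) ^ n = 0 := by
  rw [← Nat.cast_pow, ZMod.natCast_self]

theorem exists_add_eq {p e a : ℕ} (hp : p.Prime) (h : a + 4 < p) :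
    ∃ M, M + a = p ^ (e - 1) * (p - 1) ∧ 3 ≤ M := by
  have : p - 1 ≤ p ^ (e - 1) * (p - 1) := Nat.le_mul_of_pos_left _ (pow_pos hp.pos _)
  exact ⟨p ^ (e - 1) * (p - 1) - a, by omega, by omega⟩

/-- The depth-one values modulo `p ^ 2`. -/
theorem zetaA_two_singleton (a : ℕ+) :
    zetaA 2 [a] = (a : ℕ) * frakZA 2 (a + 1) * xA 2 := by
  rw [zetaA_eq]
  refine ARing.mk_eq_mk (b := ((a : ℕ) : ∀ p : Nat.Primes, ZMod ((p : ℕ) ^ 2))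
    * (fun p : Nat.Primes => ratMod ((p : ℕ) ^ 2) (frakZRat 2 (a + 1) p))
    * fun p : Nat.Primes => ((p : ℕ) : ZMod ((p : ℕ) ^ 2))) (a + 4) ?_
  rintro ⟨p, hp⟩ hpa
  dsimp only at hpa
  have ha := a.pos
  have hp2 : p ≠ 2 := by omega
  obtain ⟨M, hM, hM3⟩ := exists_add_eq (e := 2) hp hpa
  obtain ⟨c, hc, h⟩ := exists_harmonicFrom_eq hp hpa (by norm_num) (by norm_num) hM
  have hZ := frakZRat_mem_intAt hp le_rfl ha (by omega) hM
  have hB := bernoulli_mem_intAt hp hp2 (not_dvd_of_add_eq (M := M - 1) (b := a + 1) (e := 2)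
    (by omega) (by omega) (by omega))
  have h2 := inv_two_mem_intAt hp hp2
  have key : harmonicInt ⟨p, hp⟩ [a] = (a : ℕ) * ⟨_, hZ⟩ * (p : intAt p)
      + (p : intAt p) ^ 2 * ((M : intAt p) * ⟨_, h2⟩ * ⟨_, hB⟩ + ⟨c, hc⟩ + ⟨_, hZ⟩) := by
    apply Subtype.ext
    push_cast
    change harmonicFrom p 1 [a] = _
    rw [h, frakZRat_eq hM]
    have hne : ((a : ℕ) : ℚ) + (p : ℚ) ≠ 0 := by positivity
    push_cast
    rw [pow_one]
    field_simp
    ring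
  have key2 := congrArg (ratModHom p 2) key
  simp only [map_add, map_mul, map_pow, map_natCast, natCast_pow_self_eq_zero, zero_mul,
    add_zero] at key2
  exact key2

/-- The depth-one values modulo `p ^ 3`. Only one of the two Bernoulli numbers that occur is nonzero,
by parity. -/
theorem zetaA_three_singleton (a : ℕ+) :
    zetaA 3 [a] = (-1) ^ (a : ℕ) * ((a : ℕ) * frakZA 3 (a + 1) * xA 3
      + (((a : ℕ) + 1).choose 2 : ARing 3) * frakZA 3 (a + 2) * xA 3 ^ 2) := by
  rw [zetaA_eq]
  refine ARing.mk_eq_mk (b := (-1) ^ (a : ℕ)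
    * (((a : ℕ) : ∀ p : Nat.Primes, ZMod ((p : ℕ) ^ 3))
    * (fun p : Nat.Primes => ratMod ((p : ℕ) ^ 3) (frakZRat 3 (a + 1) p))
    * (fun p : Nat.Primes => ((p : ℕ) : ZMod ((p : ℕ) ^ 3)))
    + (((a : ℕ) + 1).choose 2 : ∀ p : Nat.Primes, ZMod ((p : ℕ) ^ 3))
    * (fun p : Nat.Primes => ratMod ((p : ℕ) ^ 3) (frakZRat 3 (a + 2) p))
    * (fun p : Nat.Primes => ((p : ℕ) : ZMod ((p : ℕ) ^ 3))) ^ 2)) (a + 4) ?_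
  rintro ⟨p, hp⟩ hpa
  dsimp only at hpa
  have ha := a.pos
  have hp2 : p ≠ 2 := by omega
  obtain ⟨M, hM, hM3⟩ := exists_add_eq (e := 3) hp hpa
  have hM' : M - 1 + (a + 1) = p ^ (3 - 1) * (p - 1) := by omega
  obtain ⟨c, hc, h⟩ := exists_harmonicFrom_eq hp hpa (by norm_num) (by norm_num) hM
  have hZ := frakZRat_mem_intAt hp (by norm_num) ha (by omega) hM
  have hZ' := frakZRat_mem_intAt hp (by norm_num) (by omega) (by omega) hM'
  have h2 := inv_two_mem_intAt hp hp2
  have hpo : Even (p ^ (3 - 1) * (p - 1)) := by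
    refine Even.mul_left ?_ _
    obtain ⟨t, ht⟩ := hp.odd_of_ne_two hp2
    exact ⟨t, by omega⟩
  have hMq : (M : ℚ) = (p : ℚ) ^ 2 * ((p : ℚ) - 1) - (a : ℕ) := by
    have := congrArg (Nat.cast : ℕ → ℚ) hM
    push_cast [Nat.cast_sub hp.one_lt.le] at this
    rw [← this]
    ring
  have hch : ((((a : ℕ) + 1).choose 2 : ℕ) : ℚ) = ((a : ℕ) + 1) * (a : ℕ) / 2 := by
    rw [Nat.cast_choose_two]
    push_cast
    ring
  have key : ∃ C : intAt p, harmonicInt ⟨p, hp⟩ [a] = (-1) ^ (a : ℕ) * ((a : ℕ) * ⟨_, hZ⟩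
      * (p : intAt p) + (((a : ℕ) + 1).choose 2 : ℕ) * ⟨_, hZ'⟩ * (p : intAt p) ^ 2)
      + (p : intAt p) ^ 3 * C := by
    have hne : ((a : ℕ) : ℚ) + (p : ℚ) ^ 2 ≠ 0 := by positivity
    have hne' : ((a : ℕ) : ℚ) + 1 + (p : ℚ) ^ 2 ≠ 0 := by positivity
    rcases Nat.even_or_odd (a : ℕ) with hev | hodd
    · have hB : bernoulli (M - 1) = 0 := by
        refine bernoulli_eq_zero_of_odd ?_ (by omega)
        rw [← hM] at hpo
        exact Nat.Even.sub_odd (by omega) ((Nat.even_add.1 hpo).2 hev) odd_one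
      refine ⟨⟨c, hc⟩ + ⟨_, hZ⟩, ?_⟩
      apply Subtype.ext
      rw [hev.neg_one_pow]
      push_cast
      change harmonicFrom p 1 [a] = _
      rw [h, frakZRat_eq hM, show (a : ℕ) + 2 = (a + 1) + 1 from rfl, frakZRat_eq hM', hB]
      push_cast
      field_simp
      ring
    · have hB : bernoulli M = 0 := by
        refine bernoulli_eq_zero_of_odd ?_ (by omega)
        rw [← hM] at hpo
        exact Nat.not_even_iff_odd.1 fun h => (Nat.not_even_iff_odd.2 hodd)
          ((Nat.even_add.1 hpo).1 h)
      have hB' := bernoulli_mem_intAt hp hp2 (not_dvd_of_add_eq (by omega) (by omega) hM')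
      refine ⟨⟨c, hc⟩ + p * ((p - 1) * ⟨_, h2⟩ * ⟨_, hB'⟩ - (a : ℕ) * ⟨_, h2⟩ * ⟨_, hZ'⟩), ?_⟩
      apply Subtype.ext
      rw [hodd.neg_one_pow]
      push_cast
      change harmonicFrom p 1 [a] = _
      rw [h, frakZRat_eq hM, show (a : ℕ) + 2 = (a + 1) + 1 from rfl, frakZRat_eq hM', hB, hMq,
        hch]
      push_cast
      field_simp
      ring
  obtain ⟨C, key⟩ := key
  have key2 := congrArg (ratModHom p 3) key
  simp only [map_add, map_mul, map_pow, map_neg, map_one, map_natCast, natCast_pow_self_eq_zero,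
    zero_mul, add_zero] at key2
  exact key2

/-! ### The harmonic product -/

/-- The harmonic product as a bilinear map. -/
noncomputable def harmL : H1 →ₗ[ℚ] H1 →ₗ[ℚ] H1 :=
  Finsupp.linearCombination ℚ fun u => Finsupp.linearCombination ℚ (harmWord u)

/-- The word `e_k` as an element of `𝔥¹`. -/
noncomputable abbrev word (w : Index) : H1 := Finsupp.single w 1

theorem harm_eq_harmL (f g : H1) : harm f g = harmL f g := by
  rw [harm, harmL, Finsupp.linearCombination_apply, Finsupp.sum, Finsupp.sum, LinearMap.sum_apply]
  refine Finset.sum_congr rfl fun u _ => ?_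
  rw [LinearMap.smul_apply, Finsupp.linearCombination_apply, Finsupp.sum, Finsupp.sum,
    Finset.smul_sum]
  exact Finset.sum_congr rfl fun v _ => mul_smul _ _ _

theorem harmL_word (u v : Index) : harmL (word u) (word v) = harmWord u v := by
  simp [harmL]

theorem consMap_word (a : ℕ+) (w : Index) : consMap a (word w) = word (a :: w) := by
  simp [consMap]

theorem consMap_apply_nil (a : ℕ+) (f : H1) : consMap a f [] = 0 := by
  rw [consMap, Finsupp.lmapDomain_apply, Finsupp.mapDomain_of_notMem_range]
  simp

theorem consMap_apply_cons (a b : ℕ+) (f : H1) (w : Index) :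
    consMap a f (b :: w) = if b = a then f w else 0 := by
  rw [consMap, Finsupp.lmapDomain_apply]
  split_ifs with h
  · rw [h]
    exact Finsupp.mapDomain_apply (List.cons_injective) f w
  · rw [Finsupp.mapDomain_of_notMem_range]
    rintro ⟨v, hv⟩
    rw [List.cons.injEq] at hv
    exact h hv.1.symm

theorem linearMap_ext_word {M : Type*} [AddCommGroup M] [Module ℚ M] {f g : H1 →ₗ[ℚ] M}
    (h : ∀ w, f (word w) = g (word w)) : f = g :=
  Finsupp.lhom_ext' fun w => LinearMap.ext_ring (h w)

theorem harmL_nil_left (f : H1) : harmL (word []) f = f := by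
  have : harmL (word []) = LinearMap.id := linearMap_ext_word fun w => by
    rw [harmL_word, harmWord]
    rfl
  rw [this]
  rfl

theorem harmWord_nil_right (u : Index) : harmWord u [] = word u := by
  cases u <;> rw [harmWord]

theorem harmL_nil_right (f : H1) : harmL f (word []) = f := by
  have : harmL.flip (word []) = LinearMap.id := linearMap_ext_word fun w => by
    rw [LinearMap.flip_apply, harmL_word, harmWord_nil_right]
    rfl
  exact LinearMap.congr_fun this f

theorem harmL_consMap_consMap (b c : ℕ+) (f g : H1) :
    harmL (consMap b f) (consMap c g) = consMap b (harmL f (consMap c g))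
      + consMap c (harmL (consMap b f) g) + consMap (b + c) (harmL f g) := by
  have h : (harmL ∘ₗ consMap b).compl₂ (consMap c)
      = (harmL.compl₂ (consMap c)).compr₂ (consMap b)
      + (harmL ∘ₗ consMap b).compr₂ (consMap c) + harmL.compr₂ (consMap (b + c)) := by
    refine linearMap_ext_word fun u => linearMap_ext_word fun v => ?_
    simp only [LinearMap.compl₂_apply, LinearMap.comp_apply, LinearMap.add_apply,
      LinearMap.compr₂_apply, consMap_word, harmL_word]
    rw [harmWord]
  exact LinearMap.congr_fun (LinearMap.congr_fun h f) g

/-- Harmonic multiplication by the letter `e_a`. -/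
noncomputable def letterMul (a : ℕ+) : H1 →ₗ[ℚ] H1 := harmL (word [a])

theorem letterMul_nil (a : ℕ+) : letterMul a (word []) = word [a] := harmL_nil_right _

theorem letterMul_consMap (a b : ℕ+) (f : H1) :
    letterMul a (consMap b f)
      = consMap a (consMap b f) + consMap b (letterMul a f) + consMap (a + b) f := by
  rw [letterMul, ← consMap_word, harmL_consMap_consMap, harmL_nil_left, harmL_nil_left]

theorem map_letterMul_word {M : Type*} [AddCommMonoid M] (φ : H1 →+ M) (a : ℕ+) (w : Index) :
    φ (letterMul a (word w)) = stuffle a w (fun u => φ (word u)) := by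
  have h : letterMul a (word w) = stuffle a w word := by
    induction w with
    | nil => exact letterMul_nil a
    | cons b w ih =>
      rw [← consMap_word, letterMul_consMap, stuffle, ih, consMap_word, consMap_word, consMap_word,
        ← LinearMap.toAddMonoidHom_coe, map_stuffle]
      simp only [LinearMap.toAddMonoidHom_coe, consMap_word]
      abel
  rw [h, map_stuffle]

/-- Harmonic multiplication by any element commutes with harmonic multiplication by a letter. This is
the only part of the commutativity and associativity of the harmonic product that is needed. -/
theorem harmL_letterMul (a : ℕ+) (f g : H1) :
    harmL f (letterMul a g) = letterMul a (harmL f g) := by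
  have h : ∀ u v : Index, harmL (word u) (letterMul a (word v))
      = letterMul a (harmL (word u) (word v)) := by
    intro u
    induction u with
    | nil => intro v; rw [harmL_nil_left, harmL_nil_left]
    | cons b u ihu =>
      intro v
      rw [← consMap_word]
      induction v with
      | nil =>
        have h1 := ihu []
        rw [letterMul_nil, harmL_nil_right, ← consMap_word] at h1
        rw [letterMul_nil, ← consMap_word a, harmL_consMap_consMap, harmL_nil_right,
          harmL_nil_right, letterMul_consMap, h1, add_comm b a]
        abel
      | cons c v ihv =>
        have h1 := ihu (c :: v)
        have h2 := ihu v
        rw [← consMap_word, letterMul_consMap] at h1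
        simp only [map_add] at h1
        rw [← consMap_word, letterMul_consMap, harmL_consMap_consMap]
        simp only [map_add, letterMul_consMap, harmL_consMap_consMap, ← ihv, ← h2, ← h1]
        rw [add_comm b a, show b + (a + c) = a + (b + c) by rw [add_left_comm]]
        abel
  have h' : harmL.compl₂ (letterMul a) = harmL.compr₂ (letterMul a) := by
    refine linearMap_ext_word fun u => linearMap_ext_word fun v => ?_
    simp only [LinearMap.compl₂_apply, LinearMap.compr₂_apply]
    exact h u v
  exact LinearMap.congr_fun (LinearMap.congr_fun h' f) g

theorem letterMul_comm (a b : ℕ+) (f : H1) :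
    letterMul a (letterMul b f) = letterMul b (letterMul a f) :=
  harmL_letterMul b (word [a]) f

/-! ### Deleting a final `e_1` -/

/-- The linear map deleting a final letter `e_1`; words that do not end in `e_1` are sent to `0`. -/
noncomputable def dropOne : H1 →ₗ[ℚ] H1 :=
  Finsupp.lcomapDomain (fun w : Index => w ++ [1]) (List.append_left_injective [1])

theorem dropOne_apply (f : H1) (w : Index) : dropOne f w = f (w ++ [1]) := rfl

theorem dropOne_consMap (b : ℕ+) (f : H1) :
    dropOne (consMap b f) = consMap b (dropOne f) + (if b = 1 then f [] else 0) • word [] := by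
  ext w
  rw [dropOne_apply, Finsupp.add_apply, Finsupp.smul_apply]
  cases w with
  | nil =>
    rw [List.nil_append, consMap_apply_cons, consMap_apply_nil]
    simp [eq_comm]
  | cons c w =>
    rw [List.cons_append, consMap_apply_cons, consMap_apply_cons, dropOne_apply]
    simp

theorem letterMul_word_apply_nil (a : ℕ+) (w : Index) : letterMul a (word w) [] = 0 := by
  cases w with
  | nil => simp [letterMul_nil]
  | cons b w =>
    rw [← consMap_word, letterMul_consMap, Finsupp.add_apply, Finsupp.add_apply, consMap_apply_nil,
      consMap_apply_nil, consMap_apply_nil]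
    simp

/-- `dropOne` is a derivation for the harmonic product; this is the case of one letter. -/
theorem dropOne_letterMul (a : ℕ+) (f : H1) :
    dropOne (letterMul a f) = letterMul a (dropOne f) + (if a = 1 then f else 0) := by
  have h : dropOne ∘ₗ letterMul a = letterMul a ∘ₗ dropOne
      + (if a = 1 then LinearMap.id else 0) := by
    refine linearMap_ext_word fun w => ?_
    rw [LinearMap.add_apply, LinearMap.comp_apply, LinearMap.comp_apply]
    induction w with
    | nil =>
      have h0 : dropOne (word []) = 0 := by
        ext w
        simp [dropOne_apply]
      rw [letterMul_nil, ← consMap_word, dropOne_consMap, h0]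
      split_ifs <;> simp
    | cons b w ih =>
      have hab : a + b ≠ 1 := by
        intro h
        have := congrArg PNat.val h
        have ha := a.pos
        have hb := b.pos
        simp only [PNat.add_coe, PNat.val_ofNat] at this
        omega
      rw [← consMap_word, letterMul_consMap, map_add, map_add, dropOne_consMap, dropOne_consMap,
        dropOne_consMap, ih, consMap_apply_nil, letterMul_word_apply_nil, dropOne_consMap,
        if_neg hab, map_add, map_add, map_add, letterMul_consMap, map_smul, map_smul,
        letterMul_nil, ← consMap_word a]
      by_cases ha : a = 1
      · simp only [ha, if_true, LinearMap.id_apply, ite_self, zero_smul, add_zero]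
        abel
      · simp only [ha, if_false, LinearMap.zero_apply, map_zero, ite_self, zero_smul, add_zero]
        abel
  have := LinearMap.congr_fun h f
  rw [LinearMap.add_apply, LinearMap.comp_apply, LinearMap.comp_apply] at this
  rw [this]
  split_ifs <;> simp

theorem mem_H0_iff (f : H1) : f ∈ H0 ↔ dropOne f = 0 := by
  rw [H0, Finsupp.mem_supported]
  constructor
  · intro h
    ext w
    rw [dropOne_apply, Finsupp.zero_apply]
    by_contra hne
    have := h (Finsupp.mem_support_iff.2 hne) (by simp)
    simp at this
  · intro h k hk hne
    by_contra hlt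
    have h1 : k.getLast hne = 1 := by
      apply PNat.eq
      have := (k.getLast hne).pos
      simp only [PNat.val_ofNat]
      omega
    have h2 : f k = 0 := by
      rw [← List.dropLast_append_getLast hne, h1, ← dropOne_apply, h]
      rfl
    exact (Finsupp.mem_support_iff.1 hk) h2

/-! ### Uniqueness and existence of the expansion in powers of `e_1` -/

theorem harm_e1Pow (f : H1) (i : ℕ) : harm f (e1Pow i) = ((letterMul 1) ^ i) f := by
  rw [harm_eq_harmL]
  induction i with
  | zero => exact harmL_nil_right f
  | succ i ih =>
    rw [e1Pow, harm_eq_harmL]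
    change harmL f (letterMul 1 (e1Pow i)) = _
    rw [harmL_letterMul, ih, pow_succ']
    rfl

theorem dropOne_letterMul_pow (i : ℕ) {f : H1} (hf : dropOne f = 0) :
    dropOne (((letterMul 1) ^ i) f) = (i : ℚ) • ((letterMul 1) ^ (i - 1)) f := by
  induction i with
  | zero => simp [hf]
  | succ i ih =>
    rw [pow_succ', Module.End.mul_apply, dropOne_letterMul, ih, if_pos rfl, map_smul,
      ← Module.End.mul_apply, ← pow_succ', Nat.add_sub_cancel]
    cases i with
    | zero => simp
    | succ i =>
      rw [Nat.add_sub_cancel]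
      rw [Nat.cast_succ (i + 1), add_smul, one_smul]

/-- `dropOne` acts on powers of `e_1` over `𝔥⁰` like a derivative. -/
theorem dropOne_pow_letterMul_pow (m i : ℕ) {f : H1} (hf : dropOne f = 0) :
    (dropOne ^ m) (((letterMul 1) ^ i) f)
      = (i.descFactorial m : ℚ) • ((letterMul 1) ^ (i - m)) f := by
  induction m with
  | zero => simp
  | succ m ih =>
    rw [pow_succ', Module.End.mul_apply, ih, map_smul, dropOne_letterMul_pow _ hf, smul_smul,
      Nat.descFactorial_succ, Nat.sub_sub, Nat.cast_mul, mul_comm]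

theorem dropOne_pow_letterMul_pow_self (i : ℕ) {f : H1} (hf : dropOne f = 0) :
    (dropOne ^ i) (((letterMul 1) ^ i) f) = (i.factorial : ℚ) • f := by
  rw [dropOne_pow_letterMul_pow _ _ hf, Nat.descFactorial_self, Nat.sub_self, pow_zero]
  rfl

theorem isExpansion_iff (f : H1) (c : ℕ →₀ H1) : IsExpansion f c ↔
    (∀ i, dropOne (c i) = 0) ∧ f = c.sum fun i x => ((letterMul 1) ^ i) x := by
  rw [IsExpansion]
  simp only [mem_H0_iff, harm_e1Pow]

theorem eq_zero_of_isExpansion_zero {c : ℕ →₀ H1} (h : IsExpansion 0 c) : c = 0 := by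
  rw [isExpansion_iff] at h
  by_contra hc
  have hne : c.support.Nonempty := Finsupp.support_nonempty_iff.2 hc
  set n := c.support.max' hne with hn
  have hmem : n ∈ c.support := c.support.max'_mem hne
  have h2 := congrArg (dropOne ^ n) h.2
  rw [map_zero, map_finsuppSum, Finsupp.sum, Finset.sum_eq_single n,
    dropOne_pow_letterMul_pow_self n (h.1 n)] at h2
  · rcases smul_eq_zero.1 h2.symm with h3 | h3
    · exact absurd h3 (by exact_mod_cast n.factorial_ne_zero)
    · exact (Finsupp.mem_support_iff.1 hmem) h3
  · intro i hi hin
    have hlt : i < n := lt_of_le_of_ne (c.support.le_max' i hi) hin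
    rw [dropOne_pow_letterMul_pow _ _ (h.1 i), Nat.descFactorial_of_lt hlt]
    simp
  · intro hi
    exact absurd hmem hi

theorem IsExpansion.add {f g : H1} {c d : ℕ →₀ H1} (hf : IsExpansion f c) (hg : IsExpansion g d) :
    IsExpansion (f + g) (c + d) := by
  rw [isExpansion_iff] at *
  refine ⟨fun i => by rw [Finsupp.add_apply, map_add, hf.1, hg.1, add_zero], ?_⟩
  rw [Finsupp.sum_add_index' (fun i => map_zero _) (fun i => map_add _), ← hf.2, ← hg.2]

theorem IsExpansion.neg {f : H1} {c : ℕ →₀ H1} (hf : IsExpansion f c) :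
    IsExpansion (-f) (-c) := by
  rw [isExpansion_iff] at *
  refine ⟨fun i => by rw [Finsupp.neg_apply, map_neg, hf.1, neg_zero], ?_⟩
  rw [Finsupp.sum_neg_index (fun i => map_zero _), hf.2, Finsupp.sum, Finsupp.sum,
    ← Finset.sum_neg_distrib]
  simp only [map_neg]

theorem IsExpansion.unique {f : H1} {c d : ℕ →₀ H1} (hc : IsExpansion f c)
    (hd : IsExpansion f d) : c = d := by
  have h := hc.add hd.neg
  rw [add_neg_cancel] at h
  exact add_neg_eq_zero.1 (eq_zero_of_isExpansion_zero h)

theorem isExpansion_single (i : ℕ) {f : H1} (hf : dropOne f = 0) :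
    IsExpansion (((letterMul 1) ^ i) f) (Finsupp.single i f) := by
  rw [isExpansion_iff]
  refine ⟨fun j => ?_, ?_⟩
  · rw [Finsupp.single_apply]
    split_ifs
    · exact hf
    · exact map_zero _
  · exact (Finsupp.sum_single_index (h := fun i x => ((letterMul 1) ^ i) x) (map_zero _)).symm

theorem dropOne_pow_apply (n : ℕ) (f : H1) (w : Index) :
    (dropOne ^ n) f w = f (w ++ List.replicate n 1) := by
  induction n generalizing f with
  | zero => simp
  | succ n ih =>
    rw [pow_succ, Module.End.mul_apply, ih, dropOne_apply, List.append_assoc,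
      ← List.replicate_succ']

theorem exists_isExpansion (f : H1) : ∃ c, IsExpansion f c := by
  have h : ∀ n f, (dropOne ^ n) f = 0 → ∃ c, IsExpansion f c := by
    intro n
    induction n with
    | zero =>
      intro f hf
      rw [pow_zero, Module.End.one_apply] at hf
      rw [hf]
      exact ⟨0, by simp [isExpansion_iff]⟩
    | succ n ih =>
      intro f hf
      rw [pow_succ', Module.End.mul_apply] at hf
      set g := ((n.factorial : ℚ)⁻¹) • (dropOne ^ n) f with hg
      have hg0 : dropOne g = 0 := by rw [hg, map_smul, hf, smul_zero]
      obtain ⟨c, hc⟩ := ih (f - ((letterMul 1) ^ n) g) (by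
        rw [map_sub, dropOne_pow_letterMul_pow_self n hg0, hg, smul_smul,
          mul_inv_cancel₀ (by exact_mod_cast n.factorial_ne_zero), one_smul, sub_self])
      have h2 := hc.add (isExpansion_single n hg0)
      rw [sub_add_cancel] at h2
      exact ⟨_, h2⟩
  obtain ⟨N, hN⟩ := (f.support.image List.length).exists_nat_subset_range
  refine h N f ?_
  ext w
  rw [dropOne_pow_apply, Finsupp.zero_apply]
  by_contra hne
  have := hN (Finset.mem_image_of_mem _ (Finsupp.mem_support_iff.2 hne))
  simp at this

theorem reg_eq {f : H1} {c : ℕ →₀ H1} (hc : IsExpansion f c) : reg f = c 0 := by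
  have h : ∃ c, IsExpansion f c := ⟨c, hc⟩
  rw [reg, dif_pos h, h.choose_spec.unique hc]

theorem reg_add (f g : H1) : reg (f + g) = reg f + reg g := by
  obtain ⟨c, hc⟩ := exists_isExpansion f
  obtain ⟨d, hd⟩ := exists_isExpansion g
  rw [reg_eq hc, reg_eq hd, reg_eq (hc.add hd), Finsupp.add_apply]

theorem reg_of_mem_H0 {f : H1} (hf : f ∈ H0) : reg f = f := by
  have := isExpansion_single 0 ((mem_H0_iff f).1 hf)
  rw [pow_zero, Module.End.one_apply] at this
  rw [reg_eq this, Finsupp.single_eq_same]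

theorem reg_mem_H0 (f : H1) : reg f ∈ H0 := by
  obtain ⟨c, hc⟩ := exists_isExpansion f
  rw [reg_eq hc]
  exact hc.1 0

theorem letterMul_pow_comm (a : ℕ+) (i : ℕ) (f : H1) :
    ((letterMul 1) ^ i) (letterMul a f) = letterMul a (((letterMul 1) ^ i) f) := by
  induction i with
  | zero => rfl
  | succ i ih =>
    rw [pow_succ', Module.End.mul_apply, Module.End.mul_apply, ih, letterMul_comm]

theorem reg_letterMul {a : ℕ+} (ha : a ≠ 1) (f : H1) : reg (letterMul a f) = letterMul a (reg f) := by
  obtain ⟨c, hc⟩ := exists_isExpansion f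
  rw [reg_eq hc]
  have h : IsExpansion (letterMul a f) (c.mapRange (letterMul a) (map_zero _)) := by
    rw [isExpansion_iff] at *
    refine ⟨fun i => ?_, ?_⟩
    · rw [Finsupp.mapRange_apply, dropOne_letterMul, hc.1, map_zero, if_neg ha, add_zero]
    · rw [Finsupp.sum_mapRange_index (fun i => map_zero _), hc.2, map_finsuppSum]
      simp only [letterMul_pow_comm]
  rw [reg_eq h, Finsupp.mapRange_apply]

theorem reg_letterMul_one (f : H1) : reg (letterMul 1 f) = 0 := by
  obtain ⟨c, hc⟩ := exists_isExpansion f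
  have h : IsExpansion (letterMul 1 f) (c.embDomain ⟨Nat.succ, Nat.succ_injective⟩) := by
    rw [isExpansion_iff] at *
    refine ⟨fun i => ?_, ?_⟩
    · cases i with
      | zero =>
        rw [Finsupp.embDomain_of_notMem_range _ _ _ (by simp), map_zero]
      | succ i =>
        have := Finsupp.embDomain_apply_self ⟨Nat.succ, Nat.succ_injective⟩ c i
        rw [Function.Embedding.coeFn_mk, Nat.succ_eq_add_one] at this
        rw [this, hc.1]
    · rw [Finsupp.sum_embDomain, hc.2, map_finsuppSum]
      simp only [Function.Embedding.coeFn_mk, Nat.succ_eq_add_one, pow_succ', Module.End.mul_apply]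
  rw [reg_eq h, Finsupp.embDomain_of_notMem_range _ _ _ (by simp)]

/-! ### Convergence of multiple zeta values -/

theorem Admissible.tail {b c : ℕ+} {v : Index} (h : Admissible (b :: c :: v)) :
    Admissible (c :: v) := by
  intro hne
  have := h (by simp)
  rwa [List.getLast_cons hne] at this

theorem Admissible.cons {v : Index} (h : Admissible v) (hv : v ≠ []) (b : ℕ+) :
    Admissible (b :: v) := by
  intro hne
  rw [List.getLast_cons hv]
  exact h hv

theorem admissible_singleton {a : ℕ+} : Admissible [a] ↔ 2 ≤ (a : ℕ) :=
  ⟨fun h => h (by simp), fun h _ => h⟩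

theorem admissible_add_cons {b : ℕ+} {v : Index} (h : Admissible (b :: v)) (a : ℕ+) :
    Admissible ((a + b) :: v) := by
  cases v with
  | nil =>
    rw [admissible_singleton] at *
    rw [PNat.add_coe]
    omega
  | cons c v => exact h.tail.cons (by simp) _

theorem harmonicFrom_nonneg (p m : ℕ) (w : Index) : 0 ≤ harmonicFrom p m w := by
  induction w generalizing m with
  | nil => simp [harmonicFrom]
  | cons b w ih =>
    rw [harmonicFrom]
    exact Finset.sum_nonneg fun n _ => mul_nonneg (by positivity) (ih _)

theorem sum_Ico_telescope_le (m p : ℕ) (hm : 1 ≤ m) :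
    ∑ n ∈ Finset.Ico m p, 2 / ((n : ℚ) * (n + 1)) ≤ 2 / m := by
  rcases le_or_gt p m with h | h
  · rw [Finset.Ico_eq_empty (by omega), Finset.sum_empty]
    positivity
  have key : ∀ p, m ≤ p → ∑ n ∈ Finset.Ico m p, 2 / ((n : ℚ) * (n + 1)) = 2 / m - 2 / p := by
    intro p hp
    induction p, hp using Nat.le_induction with
    | base => simp
    | succ p hp ih =>
      have hp0 : (p : ℚ) ≠ 0 := by exact_mod_cast (by omega : p ≠ 0)
      have hp1 : (p : ℚ) + 1 ≠ 0 := by positivity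
      rw [Finset.sum_Ico_succ_top hp, ih]
      push_cast
      field_simp
      ring
  rw [key p h.le]
  have : (0 : ℚ) ≤ 2 / p := by positivity
  linarith

/-- Truncated sums of admissible indices are bounded uniformly in the truncation. -/
theorem harmonicFrom_le {w : Index} (hw : Admissible w) (hne : w ≠ []) (p m : ℕ) (hm : 1 ≤ m) :
    harmonicFrom p m w ≤ 2 / m := by
  induction w generalizing m with
  | nil => exact absurd rfl hne
  | cons b w ih =>
    refine le_trans ?_ (sum_Ico_telescope_le m p hm)
    rw [harmonicFrom]
    refine Finset.sum_le_sum fun n hn => ?_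
    rw [Finset.mem_Ico] at hn
    have hn1 : (1 : ℚ) ≤ n := by exact_mod_cast (by omega : 1 ≤ n)
    cases w with
    | nil =>
      rw [admissible_singleton] at hw
      rw [harmonicFrom, mul_one]
      calc 1 / (n : ℚ) ^ (b : ℕ) ≤ 1 / (n : ℚ) ^ 2 :=
            one_div_le_one_div_of_le (by positivity) (pow_le_pow_right₀ hn1 hw)
        _ ≤ 2 / ((n : ℚ) * (n + 1)) := by
            rw [div_le_div_iff₀ (by positivity) (by positivity)]
            nlinarith
    | cons c v =>
      have h1 := ih hw.tail (by simp) (n + 1) (by omega)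
      have h2 : 1 / (n : ℚ) ^ (b : ℕ) ≤ 1 / n := by
        refine one_div_le_one_div_of_le (by positivity) ?_
        exact le_self_pow₀ hn1 b.pos.ne'
      calc 1 / (n : ℚ) ^ (b : ℕ) * harmonicFrom p (n + 1) (c :: v)
          ≤ 1 / n * (2 / ((n + 1 : ℕ) : ℚ)) :=
            mul_le_mul h2 h1 (harmonicFrom_nonneg _ _ _) (by positivity)
        _ = 2 / ((n : ℚ) * (n + 1)) := by
            push_cast
            field_simp

/-- The tuples over which the series of a multiple zeta value extends. -/
abbrev IncTuple (r : ℕ) : Type := {m : Fin r → ℕ // StrictMono m ∧ ∀ i, 0 < m i}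

open Classical in
/-- The tuples with entries below `N`. -/
noncomputable def incTuplesBelow (r N : ℕ) : Finset (IncTuple r) :=
  (Fintype.piFinset (fun _ : Fin r => Finset.Ico 1 N)).subtype
    (fun m => StrictMono m ∧ ∀ i, 0 < m i)

theorem mem_incTuplesBelow {r N : ℕ} {m : IncTuple r} :
    m ∈ incTuplesBelow r N ↔ ∀ i, m.1 i < N := by
  rw [incTuplesBelow, Finset.mem_subtype, Fintype.mem_piFinset]
  simp only [Finset.mem_Ico]
  exact ⟨fun h i => (h i).2, fun h i => ⟨m.2.2 i, h i⟩⟩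

theorem sum_incTuplesBelow (w : Index) (N : ℕ) :
    ∑ m ∈ incTuplesBelow w.length N, ∏ i, 1 / (m.1 i : ℝ) ^ (w.get i : ℕ)
      = (harmonicFrom N 1 w : ℝ) := by
  classical
  rw [← sum_strictMono_eq_harmonicFrom, incTuplesBelow,
    Finset.sum_subtype_eq_sum_filter (f := fun m : Fin w.length → ℕ =>
      ∏ i, 1 / (m i : ℝ) ^ (w.get i : ℕ))]
  push_cast
  refine Finset.sum_congr ?_ fun _ _ => rfl
  ext m
  rw [Finset.mem_filter, Finset.mem_filter, Fintype.mem_piFinset]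
  simp only [Finset.mem_Ico]
  exact ⟨fun h => ⟨h.1, h.2.1⟩, fun h => ⟨h.1, h.2, fun i => (h.1 i).1⟩⟩

theorem incTuplesBelow_mono (r : ℕ) : Monotone (incTuplesBelow r) := by
  intro N N' h m hm
  rw [mem_incTuplesBelow] at *
  exact fun i => (hm i).trans_le h

theorem exists_mem_incTuplesBelow {r : ℕ} (m : IncTuple r) : ∃ N, m ∈ incTuplesBelow r N := by
  refine ⟨∑ i, m.1 i + 1, mem_incTuplesBelow.2 fun i => ?_⟩
  have := Finset.single_le_sum (f := m.1) (fun _ _ => Nat.zero_le _) (Finset.mem_univ i)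
  omega

theorem tendsto_incTuplesBelow (r : ℕ) : Tendsto (incTuplesBelow r) atTop atTop :=
  tendsto_atTop_finset_of_monotone (incTuplesBelow_mono r) exists_mem_incTuplesBelow

theorem tendsto_harmonicFrom {w : Index} (hw : Admissible w) :
    Tendsto (fun N => (harmonicFrom N 1 w : ℝ)) atTop (𝓝 (mzv w)) := by
  have hsum : Summable (fun m : IncTuple w.length => ∏ i, 1 / (m.1 i : ℝ) ^ (w.get i : ℕ)) := by
    refine summable_of_sum_le (c := 2) (fun m => Finset.prod_nonneg fun i _ => by positivity)
      fun u => ?_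
    obtain ⟨N, hN⟩ := ((tendsto_incTuplesBelow w.length).eventually_ge_atTop u).exists
    refine (Finset.sum_le_sum_of_subset_of_nonneg hN
      fun m _ _ => Finset.prod_nonneg fun i _ => by positivity).trans ?_
    rw [sum_incTuplesBelow]
    have : harmonicFrom N 1 w ≤ 2 := by
      by_cases hne : w = []
      · rw [hne, harmonicFrom]
        norm_num
      · simpa using harmonicFrom_le hw hne N 1 le_rfl
    exact_mod_cast this
  have := hsum.hasSum.comp (tendsto_incTuplesBelow w.length)
  refine this.congr fun N => ?_
  exact sum_incTuplesBelow w N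

theorem tendsto_stuffle {h : ℕ → Index → ℝ} {y : Index → ℝ}
    (hy : ∀ u, u ≠ [] → Admissible u → Tendsto (fun N => h N u) atTop (𝓝 (y u)))
    {a : ℕ+} (ha : 2 ≤ (a : ℕ)) {w : Index} (hw : Admissible w) :
    Tendsto (fun N => stuffle a w (h N)) atTop (𝓝 (stuffle a w y)) := by
  induction w generalizing h y with
  | nil => exact hy _ (by simp) (admissible_singleton.2 ha)
  | cons b v ih =>
    refine ((hy _ (by simp) (hw.cons (by simp) a)).add
      (hy _ (by simp) (admissible_add_cons hw a))).add
        (ih (fun u hu hu' => hy _ (by simp) (hu'.cons hu b)) ?_)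
    cases v with
    | nil => exact fun h => absurd rfl h
    | cons c v => exact hw.tail

/-- Harmonic product of a convergent depth-one value with a multiple zeta value. -/
theorem mzv_mul_mzv {a : ℕ+} (ha : 2 ≤ (a : ℕ)) {w : Index} (hw : Admissible w) :
    mzv [a] * mzv w = stuffle a w mzv := by
  refine tendsto_nhds_unique ((tendsto_harmonicFrom (admissible_singleton.2 ha)).mul
    (tendsto_harmonicFrom hw)) ?_
  refine (tendsto_stuffle (fun u _ hu => tendsto_harmonicFrom hu) ha hw).congr fun N => ?_
  rw [← Rat.cast_mul, (isStuffle_harmonicFrom N 1).mul]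
  exact (map_stuffle (Rat.castHom ℝ).toAddMonoidHom a w (harmonicFrom N 1)).symm

theorem stuffle_congr_admissible {M : Type*} [AddCommMonoid M] {y z : Index → M}
    (h : ∀ u, u ≠ [] → Admissible u → y u = z u) {a : ℕ+} (ha : 2 ≤ (a : ℕ)) {w : Index}
    (hw : Admissible w) : stuffle a w y = stuffle a w z := by
  induction w generalizing y z with
  | nil => exact h _ (by simp) (admissible_singleton.2 ha)
  | cons b v ih =>
    rw [stuffle, stuffle, h _ (by simp) (hw.cons (by simp) a),
      h _ (by simp) (admissible_add_cons hw a),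
      ih (fun u hu hu' => h _ (by simp) (hu'.cons hu b)) ?_]
    cases v with
    | nil => exact fun h => absurd rfl h
    | cons c v => exact hw.tail

theorem coe_mzvIn {w : Index} (hw : Admissible w) : (mzvIn w : ℝ) = mzv w := by
  rw [mzvIn, dif_pos hw]

theorem mzvIn_mul_mzvIn {a : ℕ+} (ha : 2 ≤ (a : ℕ)) {w : Index} (hw : Admissible w) :
    mzvIn [a] * mzvIn w = stuffle a w mzvIn := by
  apply Subtype.ext
  rw [MulMemClass.coe_mul, coe_mzvIn (admissible_singleton.2 ha), coe_mzvIn hw, mzv_mul_mzv ha hw]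
  refine Eq.trans ?_ (map_stuffle MZVAlg.val.toRingHom.toAddMonoidHom a w mzvIn).symm
  exact stuffle_congr_admissible (fun u _ hu => (coe_mzvIn hu).symm) ha hw

/-! ### The product rule for regularized values -/

/-- `Z` as a linear map. -/
noncomputable def ZHom : H1 →ₗ[ℚ] MZVAlg := Finsupp.linearCombination ℚ mzvIn

theorem ZHom_apply (f : H1) : ZHom f = Z f := Finsupp.linearCombination_apply _ _

theorem ZHom_word (w : Index) : ZHom (word w) = mzvIn w := by simp [ZHom]

theorem Z_letterMul {a : ℕ+} (ha : 2 ≤ (a : ℕ)) {f : H1} (hf : f ∈ H0) :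
    Z (letterMul a f) = mzvIn [a] * Z f := by
  have h : ∀ k ∈ f.support, ZHom (letterMul a (word k)) = mzvIn [a] * ZHom (word k) := by
    intro k hk
    have hk' : Admissible k := (Finsupp.mem_supported ℚ f).1 hf hk
    rw [ZHom_word, mzvIn_mul_mzvIn ha hk', ← LinearMap.toAddMonoidHom_coe, map_letterMul_word]
    simp only [LinearMap.toAddMonoidHom_coe, ZHom_word]
  have hf' : f = ∑ k ∈ f.support, f k • word k := by
    conv_lhs => rw [← Finsupp.sum_single f]
    exact Finset.sum_congr rfl fun k _ => by simp
  rw [← ZHom_apply, ← ZHom_apply, hf']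
  simp only [map_sum, map_smul, Finset.mul_sum]
  refine Finset.sum_congr rfl fun k hk => ?_
  rw [h k hk, mul_smul_comm]

/-- The harmonic regularization as an additive homomorphism to the algebra of multiple zeta
values. -/
noncomputable def zetaRegHom : H1 →+ MZVAlg where
  toFun f := Z (reg f)
  map_zero' := by
    rw [reg_of_mem_H0 (zero_mem _), ← ZHom_apply, map_zero]
  map_add' f g := by
    simp only [← ZHom_apply, reg_add, map_add]

theorem zetaReg_singleton_one : zetaReg [1] = 0 := by
  change Z (reg (word [1])) = 0
  rw [← letterMul_nil, reg_letterMul_one, ← ZHom_apply, map_zero]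

theorem zetaReg_of_admissible {w : Index} (hw : Admissible w) : zetaReg w = mzvIn w := by
  rw [zetaReg, reg_of_mem_H0, ← ZHom_apply, ZHom_word]
  exact (Finsupp.mem_supported ℚ _).2 fun k hk => by
    have := Finsupp.support_single_subset hk
    rw [Finset.mem_singleton] at this
    rw [this]
    exact hw

theorem isStuffle_zetaReg : IsStuffle zetaReg where
  nil := by
    have h : Admissible [] := fun h => absurd rfl h
    rw [zetaReg_of_admissible h]
    apply Subtype.ext
    rw [coe_mzvIn h, mzv, tsum_eq_single ⟨fun i => i.elim0, fun i => i.elim0, fun i => i.elim0⟩]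
    · simp
    · rintro ⟨m, hm⟩ hne
      exact absurd (Subtype.ext (funext fun i => i.elim0)) hne
  mul a w := by
    refine Eq.trans ?_ (map_letterMul_word zetaRegHom a w)
    change _ = Z (reg (letterMul a (word w)))
    by_cases ha : a = 1
    · rw [ha, zetaReg_singleton_one, reg_letterMul_one, zero_mul, ← ZHom_apply, map_zero]
    · have ha2 : 2 ≤ (a : ℕ) := by
        have h1 := a.pos
        have h2 : (a : ℕ) ≠ 1 := fun h => ha (PNat.eq h)
        omega
      rw [reg_letterMul ha, Z_letterMul ha2 (reg_mem_H0 _),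
        zetaReg_of_admissible (admissible_singleton.2 ha2), zetaReg]

/-! ### Reversal, sign, shift and deconcatenation -/

theorem stuffle_append_singleton {M : Type*} [AddCommMonoid M] (a b : ℕ+) (w : Index)
    (z : Index → M) : stuffle a (w ++ [b]) z
      = stuffle a w (fun u => z (u ++ [b])) + z (w ++ [b, a]) + z (w ++ [a + b]) := by
  induction w generalizing z with
  | nil =>
    simp only [List.nil_append, stuffle, List.cons_append]
    abel
  | cons c w ih =>
    simp only [List.cons_append, stuffle, ih]
    abel

theorem stuffle_reverse {M : Type*} [AddCommMonoid M] (a : ℕ+) (w : Index) (z : Index → M) :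
    stuffle a w (fun u => z u.reverse) = stuffle a w.reverse z := by
  induction w generalizing z with
  | nil => rfl
  | cons b w ih =>
    rw [List.reverse_cons, stuffle_append_singleton, stuffle, ← ih]
    simp only [List.reverse_cons, List.append_assoc, List.cons_append, List.nil_append]
    abel

section Operations

variable {R : Type*} [CommRing R]

theorem IsStuffle.reverse {z : Index → R} (hz : IsStuffle z) : IsStuffle (fun w => z w.reverse) where
  nil := hz.nil
  mul a w := by
    rw [stuffle_reverse]
    exact hz.mul a w.reverse

theorem wt_cons (a : ℕ+) (w : Index) : wt (a :: w) = a + wt w := by simp [wt]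

theorem stuffle_pow_wt (c : R) (a : ℕ+) (w : Index) (z : Index → R) (d : R) :
    stuffle a w (fun u => d * c ^ wt u * z u) = d * c ^ ((a : ℕ) + wt w) * stuffle a w z := by
  induction w generalizing z d with
  | nil => simp [stuffle, wt]
  | cons b w ih =>
    have h : (fun u => d * c ^ wt (b :: u) * z (b :: u))
        = fun u => (d * c ^ (b : ℕ)) * c ^ wt u * z (b :: u) := by
      funext u
      rw [wt_cons]
      ring
    rw [stuffle, h, ih, stuffle]
    simp only [wt_cons, PNat.add_coe]
    ring

theorem IsStuffle.pow_wt {z : Index → R} (hz : IsStuffle z) (c : R) :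
    IsStuffle (fun w => c ^ wt w * z w) where
  nil := by simp [wt, hz.nil]
  mul a w := by
    have h := stuffle_pow_wt c a w z 1
    simp only [one_mul] at h
    rw [h, ← hz.mul, wt_cons, pow_add, pow_add]
    simp [wt]
    ring

/-- The letter `b + l`. -/
def shiftLetter (b : ℕ+) (l : ℕ) : ℕ+ := ⟨(b : ℕ) + l, Nat.add_pos_left b.pos _⟩

/-- The coefficient of `t ^ m` in the sum over all `l_j ≥ 0` of
`∏ C(k_j + l_j - 1, l_j) χ(k_1 + l_1, k_2 + l_2, …) t ^ (l_1 + l_2 + ⋯)`. It comes from the expansion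
of `1 / (n - t) ^ k` in powers of `t`. -/
def shiftCoeff : Index → (Index → R) → ℕ → R
  | [], χ, m => if m = 0 then χ [] else 0
  | b :: v, χ, m => ∑ x ∈ antidiagonal m, (((b : ℕ) + x.1 - 1).choose x.1 : R)
      * shiftCoeff v (fun u => χ (shiftLetter b x.1 :: u)) x.2

theorem shiftCoeff_add (v : Index) (χ ψ : Index → R) (m : ℕ) :
    shiftCoeff v (fun u => χ u + ψ u) m = shiftCoeff v χ m + shiftCoeff v ψ m := by
  induction v generalizing χ ψ m with
  | nil =>
    simp only [shiftCoeff]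
    split_ifs <;> simp
  | cons b v ih => simp only [shiftCoeff, ih, mul_add, Finset.sum_add_distrib]

theorem shiftCoeff_mul_left (v : Index) (c : R) (χ : Index → R) (m : ℕ) :
    shiftCoeff v (fun u => c * χ u) m = c * shiftCoeff v χ m := by
  induction v generalizing χ m with
  | nil =>
    simp only [shiftCoeff]
    split_ifs <;> simp
  | cons b v ih =>
    simp only [shiftCoeff, ih, Finset.mul_sum]
    exact Finset.sum_congr rfl fun x _ => by ring

/-- The identity `(1 - t) ^ (-a) (1 - t) ^ (-b) = (1 - t) ^ (-a - b)`, compared in degree `m`. -/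
theorem sum_antidiagonal_choose_mul_choose (a b : ℕ+) (m : ℕ) :
    ∑ x ∈ antidiagonal m, ((a : ℕ) + x.1 - 1).choose x.1 * ((b : ℕ) + x.2 - 1).choose x.2
      = ((a : ℕ) + b + m - 1).choose m := by
  obtain ⟨a', ha⟩ : ∃ n, (a : ℕ) = n + 1 := ⟨a - 1, by have := a.pos; omega⟩
  obtain ⟨b', hb⟩ : ∃ n, (b : ℕ) = n + 1 := ⟨b - 1, by have := b.pos; omega⟩
  have h := congrArg (PowerSeries.coeff m) (pow_add (PowerSeries.mk 1 : PowerSeries ℤ)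
    (a' + 1) (b' + 1))
  rw [show a' + 1 + (b' + 1) = (a' + b' + 1) + 1 by ring, PowerSeries.mk_one_pow_eq_mk_choose_add,
    PowerSeries.mk_one_pow_eq_mk_choose_add, PowerSeries.mk_one_pow_eq_mk_choose_add,
    PowerSeries.coeff_mul] at h
  simp only [PowerSeries.coeff_mk] at h
  have h' : (a' + b' + 1 + m).choose (a' + b' + 1)
      = ∑ x ∈ antidiagonal m, (a' + x.1).choose a' * (b' + x.2).choose b' := by
    exact_mod_cast h
  rw [ha, hb, show a' + 1 + (b' + 1) + m - 1 = a' + b' + 1 + m by omega,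
    Nat.choose_symm_add.symm, h']
  refine Finset.sum_congr rfl fun x _ => ?_
  rw [show a' + 1 + x.1 - 1 = a' + x.1 by omega, show b' + 1 + x.2 - 1 = b' + x.2 by omega,
    Nat.choose_symm_add, Nat.choose_symm_add]

theorem shiftCoeff_stuffle (a : ℕ+) (v : Index) (χ : Index → R) (m : ℕ) :
    ∑ x ∈ antidiagonal m, (((a : ℕ) + x.1 - 1).choose x.1 : R)
        * shiftCoeff v (fun u => stuffle (shiftLetter a x.1) u χ) x.2
      = stuffle a v (fun u => shiftCoeff u χ m) := by
  induction v generalizing χ m with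
  | nil => simp [stuffle, shiftCoeff]
  | cons b v ih =>
    have h1 : (fun u => shiftCoeff (b :: u) χ m) = fun u => ∑ x ∈ antidiagonal m,
        (((b : ℕ) + x.1 - 1).choose x.1 : R)
          * shiftCoeff u (fun u => χ (shiftLetter b x.1 :: u)) x.2 := rfl
    have hmerge : ∑ x ∈ antidiagonal m, ∑ y ∈ antidiagonal x.2,
        (((a : ℕ) + x.1 - 1).choose x.1 : R) * ((((b : ℕ) + y.1 - 1).choose y.1 : R)
          * shiftCoeff v (fun u => χ ((shiftLetter a x.1 + shiftLetter b y.1) :: u)) y.2)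
        = shiftCoeff ((a + b) :: v) χ m := by
      simp only [shiftCoeff, PNat.add_coe, ← sum_antidiagonal_choose_mul_choose, Nat.cast_sum,
        Finset.sum_mul]
      rw [Finset.sum_sigma', Finset.sum_sigma']
      refine Finset.sum_bij' (fun x _ => ⟨(x.1.1 + x.2.1, x.2.2), (x.1.1, x.2.1)⟩)
        (fun x _ => ⟨(x.2.1, x.2.2 + x.1.2), (x.2.2, x.1.2)⟩) ?_ ?_ ?_ ?_ ?_
      · rintro ⟨⟨a, b⟩, c, d⟩ h
        simp only [Finset.mem_sigma, mem_antidiagonal] at h ⊢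
        exact ⟨by omega, trivial⟩
      · rintro ⟨⟨a, b⟩, c, d⟩ h
        simp only [Finset.mem_sigma, mem_antidiagonal] at h ⊢
        exact ⟨by omega, trivial⟩
      · rintro ⟨⟨a, b⟩, c, d⟩ h
        simp only [Finset.mem_sigma, mem_antidiagonal] at h ⊢
        simp [h.2]
      · rintro ⟨⟨a, b⟩, c, d⟩ h
        simp only [Finset.mem_sigma, mem_antidiagonal] at h ⊢
        simp [h.2]
      · rintro ⟨⟨i, j⟩, c, d⟩ h
        have e : shiftLetter a i + shiftLetter b c = shiftLetter (a + b) (i + c) := by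
          apply PNat.eq
          change ((a : ℕ) + i) + ((b : ℕ) + c) = ((a : ℕ) + b) + (i + c)
          ring
        simp only [e, Nat.cast_mul]
        ring
    have hins : ∑ x ∈ antidiagonal m, ∑ y ∈ antidiagonal x.2,
        (((a : ℕ) + x.1 - 1).choose x.1 : R) * ((((b : ℕ) + y.1 - 1).choose y.1 : R)
          * shiftCoeff v (fun u => stuffle (shiftLetter a x.1) u
              (fun t => χ (shiftLetter b y.1 :: t))) y.2)
        = stuffle a v (fun u => shiftCoeff (b :: u) χ m) := by
      rw [h1, stuffle_sum]
      simp only [stuffle_mul_left, ← ih, Finset.mul_sum]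
      rw [Finset.sum_sigma', Finset.sum_sigma']
      refine Finset.sum_bij' (fun x _ => ⟨(x.2.1, x.1.1 + x.2.2), (x.1.1, x.2.2)⟩)
        (fun x _ => ⟨(x.2.1, x.1.1 + x.2.2), (x.1.1, x.2.2)⟩) ?_ ?_ ?_ ?_ ?_
      · rintro ⟨⟨a, b⟩, c, d⟩ h
        simp only [Finset.mem_sigma, mem_antidiagonal] at h ⊢
        exact ⟨by omega, trivial⟩
      · rintro ⟨⟨a, b⟩, c, d⟩ h
        simp only [Finset.mem_sigma, mem_antidiagonal] at h ⊢
        exact ⟨by omega, trivial⟩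
      · rintro ⟨⟨a, b⟩, c, d⟩ h
        simp only [Finset.mem_sigma, mem_antidiagonal] at h ⊢
        simp [h.2]
      · rintro ⟨⟨a, b⟩, c, d⟩ h
        simp only [Finset.mem_sigma, mem_antidiagonal] at h ⊢
        simp [h.2]
      · rintro ⟨⟨i, j⟩, c, d⟩ h
        dsimp only
        ring
    rw [stuffle, ← hins, ← hmerge]
    simp only [shiftCoeff, stuffle, shiftCoeff_add, Finset.mul_sum, mul_add,
      Finset.sum_add_distrib]

theorem shiftCoeff_singleton (a : ℕ+) (χ : Index → R) (m : ℕ) :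
    shiftCoeff [a] χ m = (((a : ℕ) + m - 1).choose m : R) * χ [shiftLetter a m] := by
  rw [shiftCoeff, Finset.sum_eq_single (m, 0)]
  · simp [shiftCoeff]
  · rintro ⟨i, j⟩ h hne
    rw [mem_antidiagonal] at h
    have : j ≠ 0 := by
      rintro rfl
      exact hne (by simp_all)
    simp [shiftCoeff, this]
  · intro h
    exact absurd (mem_antidiagonal.2 (add_zero m)) h

theorem IsStuffle.shift {χ : Index → R} (hχ : IsStuffle χ) :
    IsStuffle (fun w => PowerSeries.mk (shiftCoeff w χ)) where
  nil := by
    ext m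
    rw [PowerSeries.coeff_mk, shiftCoeff, PowerSeries.coeff_one, hχ.nil]
  mul a w := by
    ext m
    rw [PowerSeries.coeff_mul]
    refine Eq.trans ?_ (map_stuffle (PowerSeries.coeff m (R := R)).toAddMonoidHom a w _).symm
    simp only [LinearMap.toAddMonoidHom_coe, PowerSeries.coeff_mk]
    rw [← shiftCoeff_stuffle]
    refine Finset.sum_congr rfl fun x _ => ?_
    simp only [← hχ.mul, shiftCoeff_mul_left]
    rw [← mul_assoc]
    congr 1
    exact (shiftCoeff_singleton a χ x.1)

/-- The convolution of two functionals with respect to deconcatenation of words. -/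
def deconc (φ ψ : Index → R) (w : Index) : R :=
  ∑ i ∈ Finset.range (w.length + 1), φ (w.take i) * ψ (w.drop i)

theorem deconc_cons (φ ψ : Index → R) (b : ℕ+) (w : Index) :
    deconc φ ψ (b :: w) = φ [] * ψ (b :: w) + deconc (fun u => φ (b :: u)) ψ w := by
  rw [deconc, List.length_cons, Finset.sum_range_succ', add_comm]
  rfl

theorem deconc_nil (φ ψ : Index → R) : deconc φ ψ [] = φ [] * ψ [] := by simp [deconc]

theorem deconc_add_left (φ φ' ψ : Index → R) (w : Index) :
    deconc (fun u => φ u + φ' u) ψ w = deconc φ ψ w + deconc φ' ψ w := by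
  simp only [deconc, add_mul, Finset.sum_add_distrib]

/-- A letter is primitive for deconcatenation. -/
theorem stuffle_deconc (φ ψ : Index → R) (a : ℕ+) (w : Index) :
    stuffle a w (deconc φ ψ) = deconc (fun u => stuffle a u φ) ψ w
      + deconc φ (fun u => stuffle a u ψ) w := by
  induction w generalizing φ with
  | nil => simp [stuffle, deconc_cons, deconc_nil, add_comm]
  | cons b w ih =>
    have h : (fun u => deconc φ ψ (b :: u))
        = fun u => φ [] * ψ (b :: u) + deconc (fun u => φ (b :: u)) ψ u :=
      funext fun u => deconc_cons φ ψ b u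
    rw [stuffle, h, stuffle_add, stuffle_mul_left, ih]
    simp only [deconc_cons, stuffle, deconc_add_left]
    ring

theorem IsStuffle.deconc {φ ψ : Index → R} (hφ : IsStuffle φ) (hψ : IsStuffle ψ) :
    IsStuffle (deconc φ ψ) where
  nil := by rw [deconc_nil, hφ.nil, hψ.nil, one_mul]
  mul a w := by
    rw [stuffle_deconc, deconc_cons, deconc_nil, hφ.nil, hψ.nil]
    simp only [← hφ.mul, ← hψ.mul]
    rw [FMZV.deconc, FMZV.deconc, FMZV.deconc, ← Finset.sum_add_distrib, Finset.mul_sum]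
    exact Finset.sum_congr rfl fun i _ => by ring

end Operations

/-! ### The product rule in `S_n` -/

theorem sum_piAntidiag_eq_shiftCoeff {R : Type*} [CommRing R] (v : Index) (χ : Index → R) (m : ℕ) :
    ∑ l ∈ Finset.piAntidiag (Finset.univ : Finset (Fin v.length)) m,
      ((∏ j, (((v.get j : ℕ) + l j - 1).choose (l j)) : ℕ) : R)
        * χ (List.ofFn fun j => shiftLetter (v.get j) (l j)) = shiftCoeff v χ m := by
  induction v generalizing χ m with
  | nil =>
    rw [shiftCoeff]
    change ∑ l ∈ Finset.piAntidiag (Finset.univ : Finset (Fin 0)) m, _ = _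
    rw [Finset.univ_eq_empty, Finset.piAntidiag_empty]
    split_ifs <;> simp
  | cons b v ih =>
    simp only [shiftCoeff, ← ih, Finset.mul_sum]
    rw [Finset.sum_sigma']
    change ∑ l ∈ Finset.piAntidiag (Finset.univ : Finset (Fin (v.length + 1))) m, _ = _
    refine Finset.sum_bij' (fun l _ => ⟨(l 0, ∑ i, Fin.tail l i), Fin.tail l⟩)
      (fun x _ => Fin.cons x.1.1 x.2) ?_ ?_ ?_ ?_ ?_
    · intro l hl
      rw [Finset.mem_piAntidiag, Fin.sum_univ_succ] at hl
      rw [Finset.mem_sigma, mem_antidiagonal, Finset.mem_piAntidiag]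
      exact ⟨hl.1, rfl, fun i _ => Finset.mem_univ i⟩
    · rintro ⟨⟨i, j⟩, l⟩ h
      rw [Finset.mem_sigma, mem_antidiagonal, Finset.mem_piAntidiag] at h
      rw [Finset.mem_piAntidiag, Fin.sum_univ_succ]
      refine ⟨?_, fun i _ => Finset.mem_univ i⟩
      have h1 := h.1
      have h2 := h.2.1
      simp only [Fin.cons_zero, Fin.cons_succ] at h1 h2 ⊢
      omega
    · intro l _
      exact Fin.cons_self_tail l
    · rintro ⟨⟨i, j⟩, l⟩ h
      rw [Finset.mem_sigma, mem_antidiagonal, Finset.mem_piAntidiag] at h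
      have h2 := h.2.1
      simp only [Fin.tail_cons, Fin.cons_zero] at h2 ⊢
      rw [h2]
    · intro l _
      rw [List.ofFn_succ, ← mul_assoc, ← Nat.cast_mul]
      congr 2
      exact Fin.prod_univ_succ _

/-- The second factor in the definition of the `t`-adic symmetric multiple zeta values. -/
noncomputable def shiftedReg (v : Index) : PowerSeries MZVAlg :=
  (-1) ^ wt v * PowerSeries.mk (shiftCoeff v fun u => zetaReg u.reverse)

theorem isStuffle_shiftedReg : IsStuffle shiftedReg :=
  isStuffle_zetaReg.reverse.shift.pow_wt (-1)

theorem zetaSHatReg_eq_deconc :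
    zetaSHatReg = deconc (fun u => PowerSeries.C (zetaReg u)) shiftedReg := by
  funext k
  refine PowerSeries.ext fun m => ?_
  rw [zetaSHatReg, PowerSeries.coeff_mk, deconc, map_sum]
  refine Finset.sum_congr rfl fun i _ => ?_
  rw [PowerSeries.coeff_C_mul, shiftedReg]
  have h : ((-1 : PowerSeries MZVAlg)) ^ wt (k.drop i)
      = PowerSeries.C ((-1 : MZVAlg) ^ wt (k.drop i)) := by simp
  rw [h, PowerSeries.coeff_C_mul, PowerSeries.coeff_mk, ← sum_piAntidiag_eq_shiftCoeff]
  rw [← mul_assoc, mul_comm (zetaReg _)]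
  rfl

theorem isStuffle_zetaSHat : IsStuffle zetaSHat := by
  have h : IsStuffle zetaSHatReg := by
    rw [zetaSHatReg_eq_deconc]
    exact (isStuffle_zetaReg.map PowerSeries.C).deconc isStuffle_shiftedReg
  exact h.map (PowerSeries.map (Ideal.Quotient.mk (Ideal.span {mzvIn [2]})))

theorem isStuffle_zetaS (n : ℕ) : IsStuffle (zetaS n) := 
  IsStuffle.map (R' := SRing n) isStuffle_zetaSHat (SRing.proj n)

theorem zetaSStar_eq_starSum (n : ℕ) : zetaSStar n = starSum (zetaS n) := by
  funext w
  exact map_starSum (SRing.proj n).toAddMonoidHom zetaSHat w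

/-! ### Depth-one values in `S_n` -/

theorem tendsto_mzv_singleton {a : ℕ+} (ha : 2 ≤ (a : ℕ)) :
    Tendsto (fun N => ∑ n ∈ Finset.range N, 1 / (n : ℝ) ^ (a : ℕ)) atTop (𝓝 (mzv [a])) := by
  refine (tendsto_harmonicFrom (admissible_singleton.2 ha)).congr fun N => ?_
  simp only [harmonicFrom, mul_one]
  push_cast
  rcases Nat.eq_zero_or_pos N with rfl | hN
  · simp
  · rw [Finset.range_eq_Ico, Finset.sum_eq_sum_Ico_succ_bot hN]
    have : (a : ℕ) ≠ 0 := a.pos.ne'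
    simp [this]

theorem mzv_two_mul {a : ℕ+} {m : ℕ} (hm : m ≠ 0) (ha : (a : ℕ) = 2 * m) :
    mzv [a] = (-1 : ℝ) ^ (m + 1) * (2 : ℝ) ^ (2 * m - 1) * Real.pi ^ (2 * m) *
        bernoulli (2 * m) / (2 * m).factorial := by
  refine tendsto_nhds_unique (tendsto_mzv_singleton (a := a) (by omega)) ?_
  rw [ha]
  exact (hasSum_zeta_nat hm).tendsto_sum_nat

/-- By Euler's formula, even zeta values are rational multiples of powers of `ζ(2)`. -/
theorem mzvIn_even_mem {a : ℕ+} (ha : Even (a : ℕ)) :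
    mzvIn [a] ∈ Ideal.span {mzvIn [2]} := by
  obtain ⟨m, hm⟩ := ha
  have hpos := a.pos
  have hm0 : m ≠ 0 := by omega
  have h2 : mzv [2] = Real.pi ^ 2 / 6 := by
    refine tendsto_nhds_unique (tendsto_mzv_singleton (a := 2) (by norm_num)) ?_
    exact hasSum_zeta_two.tendsto_sum_nat
  have h : mzvIn [a] = ((-1 : ℚ) ^ (m + 1) * (2 : ℚ) ^ (2 * m - 1) * 6 ^ m * bernoulli (2 * m)
      / (2 * m).factorial) • mzvIn [2] ^ m := by
    apply Subtype.ext
    rw [coe_mzvIn (admissible_singleton.2 (by omega)), mzv_two_mul hm0 (by omega),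
      SetLike.val_smul, SubmonoidClass.coe_pow, coe_mzvIn (admissible_singleton.2 (by norm_num)),
      h2, Rat.smul_def, div_pow, ← pow_mul]
    push_cast
    have : (6 : ℝ) ^ m ≠ 0 := by positivity
    field_simp
  rw [h, Algebra.smul_def]
  exact Ideal.mul_mem_left _ _ (Ideal.pow_mem_of_mem _ (Ideal.subset_span (Set.mem_singleton _)) _
    (Nat.pos_of_ne_zero hm0))

/-- The class of `ζ(a)` modulo `ζ(2)`. -/
noncomputable def zetaBar (a : ℕ) : ZBar := Ideal.Quotient.mk _ (mzvIn [a.toPNat'])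

theorem zetaBar_even {a : ℕ} (ha : Even a) (h0 : a ≠ 0) : zetaBar a = 0 := by
  refine Ideal.Quotient.eq_zero_iff_mem.2 (mzvIn_even_mem ?_)
  rwa [Nat.toPNat'_coe, if_pos (Nat.pos_of_ne_zero h0)]

theorem frakZS_eq (n m : ℕ) : frakZS n m = SRing.proj n (PowerSeries.C (zetaBar m)) := rfl

theorem coeff_zetaSHat_singleton (a : ℕ+) (m : ℕ) : PowerSeries.coeff m (zetaSHat [a])
    = Ideal.Quotient.mk _ ((-1) ^ (a : ℕ) * ((((a : ℕ) + m - 1).choose m : MZVAlg)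
      * zetaReg [shiftLetter a m]) + if m = 0 then zetaReg [a] else 0) := by
  rw [zetaSHat, PowerSeries.coeff_map, zetaSHatReg_eq_deconc, deconc_cons, deconc_nil,
    isStuffle_shiftedReg.nil, isStuffle_zetaReg.nil, map_one, one_mul, mul_one, map_add,
    PowerSeries.coeff_C, shiftedReg]
  have h : ((-1 : PowerSeries MZVAlg)) ^ wt [a]
      = PowerSeries.C ((-1 : MZVAlg) ^ (a : ℕ)) := by simp [wt]
  rw [h, PowerSeries.coeff_C_mul, PowerSeries.coeff_mk, shiftCoeff_singleton]
  rfl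

theorem zetaReg_singleton {a : ℕ+} (ha : 2 ≤ (a : ℕ)) : zetaReg [a] = mzvIn [a] :=
  zetaReg_of_admissible (admissible_singleton.2 ha)

/-- The two terms of the constant coefficient cancel for odd `a`, and both are multiples of `ζ(2)`
for even `a`. -/
theorem coeff_zero_zetaSHat_singleton (a : ℕ+) : PowerSeries.coeff 0 (zetaSHat [a]) = 0 := by
  have h : shiftLetter a 0 = a := PNat.eq (by simp [shiftLetter])
  rw [coeff_zetaSHat_singleton, if_pos rfl, h, Nat.choose_zero_right, Nat.cast_one, one_mul]
  rcases Nat.even_or_odd (a : ℕ) with ha | ha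
  · have ha2 : 2 ≤ (a : ℕ) := by
      have := a.pos
      obtain ⟨m, hm⟩ := ha
      omega
    rw [zetaReg_singleton ha2]
    exact Ideal.Quotient.eq_zero_iff_mem.2 (Ideal.add_mem _
      (Ideal.mul_mem_left _ _ (mzvIn_even_mem ha)) (mzvIn_even_mem ha))
  · rw [ha.neg_one_pow, neg_one_mul, neg_add_cancel, map_zero]

theorem coeff_pos_zetaSHat_singleton (a : ℕ+) {m : ℕ} (hm : 0 < m) :
    PowerSeries.coeff m (zetaSHat [a])
      = (-1) ^ (a : ℕ) * ((((a : ℕ) + m - 1).choose m : ZBar) * zetaBar (a + m)) := by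
  have ha := a.pos
  have h : shiftLetter a m = ((a : ℕ) + m).toPNat' :=
    PNat.eq (by rw [Nat.toPNat'_coe, if_pos (by omega)]; rfl)
  have h2 : 2 ≤ (shiftLetter a m : ℕ) := by
    change 2 ≤ (a : ℕ) + m
    omega
  rw [coeff_zetaSHat_singleton, if_neg hm.ne', add_zero, zetaReg_singleton h2, h, zetaBar, map_mul,
    map_mul, map_pow, map_neg, map_one, map_natCast]

theorem SRing.xS_pow (n : ℕ) : xS n ^ n = 0 := by
  rw [xS, ← map_pow]
  exact Ideal.Quotient.eq_zero_iff_mem.2 (Ideal.subset_span (Set.mem_singleton _))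

theorem SRing.proj_eq_sum (n : ℕ) (P : PowerSeries ZBar) : SRing.proj n P
    = ∑ i ∈ Finset.range n, SRing.proj n (PowerSeries.C (PowerSeries.coeff i P)) * xS n ^ i := by
  simp only [xS, ← map_pow, ← map_mul, ← map_sum]
  refine Ideal.Quotient.eq.2 (Ideal.mem_span_singleton.2 (PowerSeries.X_pow_dvd_iff.2 ?_))
  intro m hm
  rw [map_sub, map_sum, Finset.sum_eq_single m]
  · rw [PowerSeries.coeff_C_mul, PowerSeries.coeff_X_pow, if_pos rfl, mul_one, sub_self]
  · intro i _ hi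
    rw [PowerSeries.coeff_C_mul, PowerSeries.coeff_X_pow, if_neg hi.symm, mul_zero]
  · intro h
    exact absurd (Finset.mem_range.2 hm) h

/-- The depth-one values modulo `t ^ 2`. -/
theorem zetaS_two_singleton (a : ℕ+) :
    zetaS 2 [a] = (a : ℕ) * frakZS 2 (a + 1) * xS 2 := by
  have h : (-1) ^ (a : ℕ) * ((((a : ℕ) + 1 - 1).choose 1 : ZBar) * zetaBar (a + 1))
      = ((a : ℕ) : ZBar) * zetaBar (a + 1) := by
    rw [Nat.add_sub_cancel, Nat.choose_one_right]
    rcases Nat.even_or_odd (a : ℕ) with ha | ha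
    · exact (congrArg (fun y : ZBar => y * _) ha.neg_one_pow).trans (one_mul _)
    · rw [zetaBar_even ha.add_one (by omega), mul_zero, mul_zero]
  rw [zetaS, SRing.proj_eq_sum, Finset.sum_range_succ, Finset.sum_range_one,
    coeff_zero_zetaSHat_singleton, coeff_pos_zetaSHat_singleton a one_pos, h]
  simp only [map_mul, map_natCast, map_zero, frakZS_eq]
  ring

/-- The depth-one values modulo `t ^ 3`. -/
theorem zetaS_three_singleton (a : ℕ+) :
    zetaS 3 [a] = (-1) ^ (a : ℕ) * ((a : ℕ) * frakZS 3 (a + 1) * xS 3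
      + (((a : ℕ) + 1).choose 2 : SRing 3) * frakZS 3 (a + 2) * xS 3 ^ 2) := by
  rw [zetaS, SRing.proj_eq_sum, Finset.sum_range_succ, Finset.sum_range_succ, Finset.sum_range_one,
    coeff_zero_zetaSHat_singleton, coeff_pos_zetaSHat_singleton a one_pos,
    coeff_pos_zetaSHat_singleton a two_pos, Nat.add_sub_cancel, Nat.choose_one_right,
    show (a : ℕ) + 2 - 1 = a + 1 from rfl]
  simp only [map_mul, map_natCast, map_pow, map_neg, map_one, map_zero, frakZS_eq]
  ring

end FMZV

theorem mainTheorem3 (k r : ℕ) (hr : 1 ≤ r) (hrk : r ≤ k) :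
    (FMZV.S (FMZV.zetaA 2) k r
        = (-1) ^ (r - 1) * (k.choose r : FMZV.ARing 2) * FMZV.frakZA 2 (k + 1) * FMZV.xA 2 ∧
      FMZV.S (FMZV.zetaAStar 2) k r
        = (k.choose r : FMZV.ARing 2) * FMZV.frakZA 2 (k + 1) * FMZV.xA 2 ∧
      FMZV.S (FMZV.zetaS 2) k r
        = (-1) ^ (r - 1) * (k.choose r : FMZV.SRing 2) * FMZV.frakZS 2 (k + 1) * FMZV.xS 2 ∧
      FMZV.S (FMZV.zetaSStar 2) k r
        = (k.choose r : FMZV.SRing 2) * FMZV.frakZS 2 (k + 1) * FMZV.xS 2) ∧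
    (FMZV.S (FMZV.zetaA 3) k r
        = (-1) ^ (k + r - 1) * ((k.choose r : FMZV.ARing 3) * FMZV.frakZA 3 (k + 1) * FMZV.xA 3
          + ((((k : ℚ) + 1) / 2 * (k.choose r : ℚ)) • FMZV.frakZA 3 (k + 2)
            - (1 / (r.factorial : ℚ)) • FMZV.T (FMZV.frakZA 3) k r) * FMZV.xA 3 ^ 2) ∧
      FMZV.S (FMZV.zetaAStar 3) k r
        = (-1) ^ k * ((k.choose r : FMZV.ARing 3) * FMZV.frakZA 3 (k + 1) * FMZV.xA 3
          + ((((k : ℚ) + 1) / 2 * (k.choose r : ℚ)) • FMZV.frakZA 3 (k + 2)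
            + (1 / (r.factorial : ℚ)) • FMZV.T (FMZV.frakZA 3) k r) * FMZV.xA 3 ^ 2) ∧
      FMZV.S (FMZV.zetaS 3) k r
        = (-1) ^ (k + r - 1) * ((k.choose r : FMZV.SRing 3) * FMZV.frakZS 3 (k + 1) * FMZV.xS 3
          + ((((k : ℚ) + 1) / 2 * (k.choose r : ℚ)) • FMZV.frakZS 3 (k + 2)
            - (1 / (r.factorial : ℚ)) • FMZV.T (FMZV.frakZS 3) k r) * FMZV.xS 3 ^ 2) ∧
      FMZV.S (FMZV.zetaSStar 3) k r
        = (-1) ^ k * ((k.choose r : FMZV.SRing 3) * FMZV.frakZS 3 (k + 1) * FMZV.xS 3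
          + ((((k : ℚ) + 1) / 2 * (k.choose r : ℚ)) • FMZV.frakZS 3 (k + 2)
            + (1 / (r.factorial : ℚ)) • FMZV.T (FMZV.frakZS 3) k r) * FMZV.xS 3 ^ 2)) := by
  rw [FMZV.zetaAStar_eq_starSum, FMZV.zetaAStar_eq_starSum, FMZV.zetaSStar_eq_starSum,
    FMZV.zetaSStar_eq_starSum]
  obtain ⟨a1, a2⟩ := (FMZV.isStuffle_zetaA 2).sum_formula_sq (FMZV.xA_pow 2)
    FMZV.zetaA_two_singleton k r hr
  obtain ⟨s1, s2⟩ := (FMZV.isStuffle_zetaS 2).sum_formula_sq (FMZV.SRing.xS_pow 2)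
    FMZV.zetaS_two_singleton k r hr
  obtain ⟨a3, a4⟩ := (FMZV.isStuffle_zetaA 3).sum_formula_cube (FMZV.xA_pow 3)
    FMZV.zetaA_three_singleton k r hr
  obtain ⟨s3, s4⟩ := (FMZV.isStuffle_zetaS 3).sum_formula_cube (FMZV.SRing.xS_pow 3)
    FMZV.zetaS_three_singleton k r hr
  exact ⟨⟨a1, a2, s1, s2⟩, a3, a4, s3, s4⟩
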